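/- **Setting.** Let $d=(d_1,\dots,d_n)$, $n\ge 1$, be a graphical degree sequence with positive components. Let $\mathcal G(d)$ be the set of simple graphs on the labelled nodes $1,\dots,n$ with degrees $d_1,\dots,d_n$, and let $\mathcal G'(d)$ be the set of simple graphs on these nodes whose degrees $d'_1,\dots,d'_n$ satisfy $d'_j\le d_j$ for all $j$ and $\sum_j|d_j-d'_j|\le 2$. The *JS chain* on $\mathcal G'(d)$ moves from $G$ as follows. With probability $1/2$ it does nothing. Otherwise it selects an ordered pair $(i,j)$ of distinct nodes uniformly at random, and: * if $G\in\mathcal G(d)$ and $ij$ is an edge of $G$, it deletes $ij$; * if $G\notin\mathcal G(d)$, the degree of $i$ in $G$ is less than $d_i$ and $ij$ is not an edge of $G$, it adds $ij$; if the new degree of $j$ exceeds $d_j$, it then selects an edge $jk$ incident to $j$ in the new graph uniformly at random and deletes it; * in all other cases it does nothing. Let $P$ be its transition matrix. The *state space graph* has node set $\mathcal G'(d)$ and arcs $(x,y)$ for $x\ne y$ with $P(x,y)>0$. Let $k_{JS}(d)$ be the maximum over $G\in\mathcal G'(d)$ of the distance from $G$ to $\mathcal G(d)$ in the state space graph. A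 family $\mathcal D$ of such sequences is *strongly stable with respect to* the constant $k$ if $k_{JS}(d)\le k$ for all $d\in\mathcal D$. For states $x\neq y$ let $\mathcal P_{xy}$ be the set of simple directed paths from $x$ to $y$ in the state space graph, and let $\mathcal P=\bigcup_{x\ne y}\mathcal P_{xy}$. With $\pi$ the uniform distribution on $\mathcal G'(d)$, a *multicommodity flow* is a function $f:\mathcal P\to[0,\infty)$ with $\sum_{q\in\mathcal P_{xy}}f(q)=\pi(x)\pi(y)$ for all $x\neq y$. Put $f(e)=\sum_{q\ni e}f(q)$ for an arc $e$, and let $\ell(f)$ be the maximum number of arcs of a path $q\in\mathcal P$ with $f(q)>0$. **Theorem.** Let $\mathcal D$ be a family of graphical degree sequences with positive components that is strongly stable with respect to some constant $k$. Then there are polynomials $p$, $r$ and $s$ such that, for every $d=(d_1,\dots,d_n)\in\mathcal D$, the JS chain on $\mathcal G'(d)$ is time-reversible with uniform stationary distribution and has a multicommodity flow $f$ with $$\max_e f(e)\le \frac{p(n)}{|\mathcal G'(d)|}\qquad\text{and}\qquad \ell(f)\le r(n).$$ This flow is efficient, in the sense that moreover $1/P(x,y)\le s(n)$ for every arc $(x,y)$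 of the state space graph, and $\ln|\mathcal G'(d)|\le s(n)$. -/

import Mathlib

noncomputable section

open scoped Classical

/-! ### Finite Markov chains, state space graphs and multicommodity flows -/

section Chains

variable {Ω : Type*} [Fintype Ω]

/-- `P` is the transition matrix of a Markov chain on `Ω` that is time-reversible with respect to
the probability distribution `π` (detailed balance); in particular `π` is stationary for `P`. -/
structure IsReversibleChain (P : Ω → Ω → ℝ) (π : Ω → ℝ) : Prop where
  nonneg : ∀ x y, 0 ≤ P x y
  row_sum : ∀ x, ∑ y, P x y = 1
  dist_nonneg : ∀ x, 0 ≤ π x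
  dist_sum : ∑ x, π x = 1
  detailed_balance : ∀ x y, π x * P x y = π y * P y x

/-- The uniform distribution on `Ω`. -/
def uniformDist (Ω : Type*) [Fintype Ω] : Ω → ℝ := fun _ => 1 / (Fintype.card Ω : ℝ)

/-- `(x, y)` is an arc of the state space graph of the chain with transition matrix `P`. -/
def IsArc (P : Ω → Ω → ℝ) (x y : Ω) : Prop := x ≠ y ∧ 0 < P x y

/-- The finite set `𝒫_{xy}` of simple directed paths from `x` to `y` in the state space graph. A
path is given by the list of the states that it visits. -/
def simplePaths (P : Ω → Ω → ℝ) (x y : Ω) : Finset (List Ω) :=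
  ((Finset.univ : Finset {l : List Ω // l.Nodup}).map (Function.Embedding.subtype _)).filter
    fun l => l.IsChain (IsArc P) ∧ l.head? = some x ∧ l.getLast? = some y

/-- The set `𝒫` of all simple paths between two distinct states. -/
def allSimplePaths (P : Ω → Ω → ℝ) : Finset (List Ω) :=
  ((Finset.univ : Finset (Ω × Ω)).filter fun e => e.1 ≠ e.2).biUnion
    fun e => simplePaths P e.1 e.2

/-- The number of arcs of a path. -/
def pathLength (l : List Ω) : ℕ := l.length - 1

/-- `f` is a multicommodity flow for the chain with transition matrix `P` and stationary
distribution `π`. Only the values of `f` on `allSimplePaths P` are ever used. -/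
def IsFlow (P : Ω → Ω → ℝ) (π : Ω → ℝ) (f : List Ω → ℝ) : Prop :=
  (∀ l ∈ allSimplePaths P, 0 ≤ f l) ∧
    ∀ x y, x ≠ y → ∑ l ∈ simplePaths P x y, f l = π x * π y

/-- The total flow `f(e)` routed through the arc `e = (u, v)`: the sum of `f` over all the simple
paths on which `u` is immediately followed by `v`. -/
def edgeFlow (P : Ω → Ω → ℝ) (f : List Ω → ℝ) (u v : Ω) : ℝ :=
  ∑ l ∈ (allSimplePaths P).filter (fun l => [u, v] <:+: l), f l

end Chains

/-! ### Degree sequences and the Jerrum-Sinclair chain -/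

section JS

variable {n : ℕ}

/-- `G` is a graphical realization of `d`, that is, an element of `𝒢(d)`. -/
def IsRealization (d : Fin n → ℕ) (G : SimpleGraph (Fin n)) : Prop :=
  ∀ v, G.degree v = d v

/-- `G` is an element of `𝒢'(d)`: no degree exceeds the prescribed one, and the total degree
deficit is at most two. -/
def IsNearRealization (d : Fin n → ℕ) (G : SimpleGraph (Fin n)) : Prop :=
  (∀ v, G.degree v ≤ d v) ∧ ∑ v, |(d v : ℤ) - (G.degree v : ℤ)| ≤ 2

/-- The state space `𝒢'(d)` of the JS chain. -/
abbrev JSState (d : Fin n → ℕ) : Type := {G : SimpleGraph (Fin n) // IsNearRealization d G}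

instance (d : Fin n → ℕ) : Fintype (JSState d) := Fintype.ofFinite _

/-- The probability that a (non-lazy) step of the JS chain leads from `G` to `G'`, given that the
ordered pair `(i, j)` of distinct nodes was selected. -/
def jsMove (d : Fin n → ℕ) (G : SimpleGraph (Fin n)) (i j : Fin n)
    (G' : SimpleGraph (Fin n)) : ℝ :=
  if IsRealization d G ∧ G.Adj i j then
    -- delete the edge `ij`
    if G' = G.deleteEdges {s(i, j)} then 1 else 0
  else if ¬ IsRealization d G ∧ G.degree i < d i ∧ ¬ G.Adj i j then
    if d j < (G ⊔ SimpleGraph.edge i j).degree j then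
      -- add the edge `ij`, then delete a uniformly random edge `jk`
      ∑ k ∈ (G ⊔ SimpleGraph.edge i j).neighborFinset j,
        if G' = (G ⊔ SimpleGraph.edge i j).deleteEdges {s(j, k)} then
          1 / ((G ⊔ SimpleGraph.edge i j).degree j : ℝ) else 0
    else
      -- add the edge `ij`
      if G' = G ⊔ SimpleGraph.edge i j then 1 else 0
  else
    -- do nothing
    if G' = G then 1 else 0

/-- The transition matrix of the (lazy) JS chain on `𝒢'(d)`: with probability `1/2` do nothing,
otherwise select one of the `n (n - 1)` ordered pairs of distinct nodes uniformly at random. -/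
def jsP (d : Fin n → ℕ) (G G' : JSState d) : ℝ :=
  1 / 2 * (if G' = G then 1 else 0) +
    1 / 2 * ∑ e ∈ (Finset.univ : Finset (Fin n)).offDiag,
      1 / ((n : ℝ) * ((n : ℝ) - 1)) * jsMove d G.1 e.1 e.2 G'.1

/-- The parameter `k_JS(d)`: the maximum over `G ∈ 𝒢'(d)` of the distance from `G` to `𝒢(d)` in
the state space graph of the JS chain (`⊤` if some `G` has no path to `𝒢(d)`). -/
def kJS (d : Fin n → ℕ) : ℕ∞ :=
  ⨆ G : JSState d, ⨅ H : {H : JSState d // IsRealization d H.1},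
    ⨅ l ∈ simplePaths (jsP d) G H.1, (pathLength l : ℕ∞)

end JS

/-- `𝒟` is a family of (non-empty) graphical degree sequences with positive components; `𝒟 n` is
the set of its members that have `n` components. -/
def IsGraphicalFamily (𝒟 : (n : ℕ) → Set (Fin n → ℕ)) : Prop :=
  ∀ n, ∀ d ∈ 𝒟 n, 0 < n ∧ (∀ i, 0 < d i) ∧ ∃ G : SimpleGraph (Fin n), IsRealization d G

/-- `𝒟` is strongly stable with respect to the constant `k`. -/
def IsStronglyStable (𝒟 : (n : ℕ) → Set (Fin n → ℕ)) (k : ℕ) : Prop :=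
  ∀ n, ∀ d ∈ 𝒟 n, kJS d ≤ (k : ℕ∞)

end

open scoped Classical symmDiff
open SimpleGraph

noncomputable section

variable {n : ℕ} {d : Fin n → ℕ}

/-! All demand is routed through realizations. Strong stability gives each state x a path of at most
k arcs to some realization h(x). A state has at most n^3 neighbours, so a given state lies on the
paths of at most (n^3+1)^k states x (`exists_retraction`). The demand from x to y goes from x to
h(x), then along a canonical route to h(y), then backwards along the path of y. Going backwards is
possible because P is symmetric (`jsP_symm`), which also gives reversibility.

For realizations G and H put D = G ∆ H. At every node D has as many edges of G as of H, so G-edges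
can be paired with H-edges. A pairing σ at all nodes splits D into alternating circuits. Its route
switches them one at a time: delete a G-edge, then repeatedly add the next H-edge and delete the
next G-edge, and close up by adding the last H-edge. These are moves of the chain
(`reach_realization`). The demand is split equally among all σ; their number, `pairingCount D`,
depends on D only.

Congestion is bounded by an encoding. If Z lies on the route, then D ∆ Z has degrees 2d - deg Z and
is a state L up to at most two extra edges, so Z, L and those edges determine D. The pairing σ
alternates with respect to Z except at two half-edges, the ends of the switched part of the current
circuit. Once these are recorded, at most `pairingCount D` choices of σ remain, and σ with the
position on the route yields G and H. Since each route has weight 1 / `pairingCount D`, each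
encoding accounts for weight at most 1. Hence the routes through Z have total weight at most a
polynomial times the number of states (`sum_routesThrough_le`), and the factor 1/|𝒢'(d)|^2 of the
demands turns this into the claimed bound. -/

/-! ### Degrees under edge insertion and deletion -/

/-- The degree of `v` in `G` as an integer. -/
def intDegree (G : SimpleGraph (Fin n)) (v : Fin n) : ℤ := ∑ a, if G.Adj v a then 1 else 0

lemma degree_eq_intDegree (G : SimpleGraph (Fin n)) (v : Fin n) [Fintype (G.neighborSet v)] :
    (G.degree v : ℤ) = intDegree G v := by
  unfold intDegree
  rw [← SimpleGraph.card_neighborFinset_eq_degree, Finset.sum_boole]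
  congr 2
  ext a
  simp

lemma intDegree_le (G : SimpleGraph (Fin n)) (v : Fin n) : intDegree G v ≤ n := by
  unfold intDegree
  calc _ ≤ ∑ _a : Fin n, (1 : ℤ) := Finset.sum_le_sum fun a _ => by split_ifs <;> norm_num
    _ = n := by simp

lemma sum_ite_edge (a b v : Fin n) (hab : a ≠ b) :
    (∑ c, if (edge a b).Adj v c then (1 : ℤ) else 0)
      = (if v = a then 1 else 0) + if v = b then 1 else 0 := by
  have : ∀ c, (if (edge a b).Adj v c then (1 : ℤ) else 0)
      = (if c = b then (if v = a then 1 else 0) else 0)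
        + if c = a then (if v = b then 1 else 0) else 0 := by
    intro c
    simp only [edge_adj]
    by_cases h1 : v = a <;> by_cases h2 : v = b <;> by_cases h3 : c = a <;> by_cases h4 : c = b <;>
      simp_all
  simp only [this, Finset.sum_add_distrib, Finset.sum_ite_eq', Finset.mem_univ, if_true]

lemma intDegree_sup_edge {G : SimpleGraph (Fin n)} {a b : Fin n} (hab : a ≠ b)
    (h : ¬ G.Adj a b) (v : Fin n) :
    intDegree (G ⊔ edge a b) v
      = intDegree G v + (if v = a then 1 else 0) + if v = b then 1 else 0 := by
  rw [add_assoc, ← sum_ite_edge a b v hab]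
  unfold intDegree
  rw [← Finset.sum_add_distrib]
  refine Finset.sum_congr rfl fun c _ => ?_
  by_cases h1 : (edge a b).Adj v c
  · have : ¬ G.Adj v c := by
      rw [edge_adj] at h1
      rcases h1.1 with ⟨rfl, rfl⟩ | ⟨rfl, rfl⟩
      · exact h
      · rwa [G.adj_comm]
    simp [h1, this]
  · simp [h1]

lemma sdiff_sup_edge {G : SimpleGraph (Fin n)} {a b : Fin n} (h : G.Adj a b) :
    G \ edge a b ⊔ edge a b = G :=
  sdiff_sup_cancel ((edge_le_iff _).2 (Or.inr h))

lemma not_adj_sdiff_edge (G : SimpleGraph (Fin n)) (a b : Fin n) :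
    ¬ (G \ edge a b).Adj a b := by
  rw [sdiff_adj, edge_adj]
  rintro ⟨h, h'⟩
  exact h' ⟨Or.inl ⟨rfl, rfl⟩, h.ne⟩

lemma sup_sdiff_edge {G : SimpleGraph (Fin n)} {a b : Fin n} (h : ¬ G.Adj a b) :
    (G ⊔ edge a b) \ edge a b = G := by
  rw [sup_sdiff_right_self, sdiff_edge G h]

lemma intDegree_sdiff_edge {G : SimpleGraph (Fin n)} {a b : Fin n} (h : G.Adj a b) (v : Fin n) :
    intDegree (G \ edge a b) v
      = intDegree G v - (if v = a then 1 else 0) - if v = b then 1 else 0 := by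
  have := intDegree_sup_edge h.ne (not_adj_sdiff_edge G a b) v
  rw [sdiff_sup_edge h] at this
  linarith

/-! ### The state space -/

lemma isRealization_iff {G : SimpleGraph (Fin n)} :
    IsRealization d G ↔ ∀ v, intDegree G v = d v := by
  unfold IsRealization
  refine forall_congr' fun v => ?_
  rw [← degree_eq_intDegree]; norm_cast

lemma isNearRealization_iff {G : SimpleGraph (Fin n)} :
    IsNearRealization d G ↔
      (∀ v, intDegree G v ≤ d v) ∧ ∑ v, ((d v : ℤ) - intDegree G v) ≤ 2 := by
  unfold IsNearRealization
  have h1 : (∀ v, G.degree v ≤ d v) ↔ ∀ v, intDegree G v ≤ d v := by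
    refine forall_congr' fun v => ?_
    rw [← degree_eq_intDegree]; norm_cast
  rw [h1]
  refine and_congr_right fun h => ?_
  have : ∑ v, |(d v : ℤ) - (G.degree v : ℤ)| = ∑ v, ((d v : ℤ) - intDegree G v) := by
    refine Finset.sum_congr rfl fun v _ => ?_
    rw [degree_eq_intDegree, abs_of_nonneg]
    linarith [h v]
  rw [this]

lemma IsRealization.isNearRealization {G : SimpleGraph (Fin n)} (h : IsRealization d G) :
    IsNearRealization d G := by
  rw [isRealization_iff] at h
  rw [isNearRealization_iff]
  refine ⟨fun v => (h v).le, ?_⟩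
  simp [h]

lemma isNearRealization_of_deficit {G : SimpleGraph (Fin n)} (a b : Fin n)
    (h : ∀ v, intDegree G v = d v - (if v = a then 1 else 0) - if v = b then 1 else 0) :
    IsNearRealization d G := by
  rw [isNearRealization_iff]
  refine ⟨fun v => ?_, ?_⟩
  · rw [h v]; split_ifs <;> linarith
  · have : ∀ v, (d v : ℤ) - intDegree G v = (if v = a then 1 else 0) + if v = b then 1 else 0 := by
      intro v; rw [h v]; ring
    simp [this, Finset.sum_add_distrib]

lemma isNearRealization_sdiff {G : SimpleGraph (Fin n)} {i j : Fin n} (hG : IsRealization d G)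
    (h : G.Adj i j) : IsNearRealization d (G \ edge i j) := by
  refine isNearRealization_of_deficit i j fun v => ?_
  rw [intDegree_sdiff_edge h, isRealization_iff.1 hG]

/-- The total deficit is at most two, and both end nodes are deficient, so the new edge uses up the
whole deficit. -/
lemma isRealization_sup {G : SimpleGraph (Fin n)} {i j : Fin n} (hG : IsNearRealization d G)
    (hij : i ≠ j) (h : ¬ G.Adj i j) (hi : intDegree G i < d i) (hj : intDegree G j < d j) :
    IsRealization d (G ⊔ edge i j) := by
  rw [isRealization_iff]
  rw [isNearRealization_iff] at hG
  have key : ∀ v, 0 ≤ (d v : ℤ) - intDegree (G ⊔ edge i j) v := by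
    intro v
    rw [intDegree_sup_edge hij h]
    have := hG.1 v
    by_cases h1 : v = i
    · subst h1; simp [hij]; linarith
    · by_cases h2 : v = j
      · subst h2; simp [h1]; linarith
      · simp [h1, h2, this]
  have hs : ∑ v, ((d v : ℤ) - intDegree (G ⊔ edge i j) v) ≤ 0 := by
    have : ∀ v, (d v : ℤ) - intDegree (G ⊔ edge i j) v = ((d v : ℤ) - intDegree G v)
        - ((if v = i then 1 else 0) + if v = j then 1 else 0) := by
      intro v; rw [intDegree_sup_edge hij h]; ring
    simp only [this, Finset.sum_sub_distrib, Finset.sum_add_distrib, Finset.sum_ite_eq',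
      Finset.mem_univ, if_true]
    have := hG.2
    rw [Finset.sum_sub_distrib] at this
    linarith
  have h0 := (Finset.sum_eq_zero_iff_of_nonneg fun v _ => key v).1
    (le_antisymm hs (Finset.sum_nonneg fun v _ => key v))
  intro v
  linarith [h0 v (Finset.mem_univ v)]

lemma intDegree_shift {G : SimpleGraph (Fin n)} {i j k : Fin n} (hij : i ≠ j) (h : ¬ G.Adj i j)
    (hk : (G ⊔ edge i j).Adj j k) (v : Fin n) :
    intDegree ((G ⊔ edge i j) \ edge j k) v
      = intDegree G v + (if v = i then 1 else 0) - if v = k then 1 else 0 := by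
  rw [intDegree_sdiff_edge hk, intDegree_sup_edge hij h]
  ring

lemma isNearRealization_shift {G : SimpleGraph (Fin n)} {i j k : Fin n}
    (hG : IsNearRealization d G) (hij : i ≠ j) (h : ¬ G.Adj i j) (hi : intDegree G i < d i)
    (hk : (G ⊔ edge i j).Adj j k) : IsNearRealization d ((G ⊔ edge i j) \ edge j k) := by
  rw [isNearRealization_iff] at hG ⊢
  constructor
  · intro v
    rw [intDegree_shift hij h hk]
    have := hG.1 v
    by_cases h1 : v = i
    · subst h1; split_ifs <;> linarith
    · simp only [h1, if_false]; split_ifs <;> linarith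
  · have : ∀ v, (d v : ℤ) - intDegree ((G ⊔ edge i j) \ edge j k) v = ((d v : ℤ) - intDegree G v)
        - (if v = i then 1 else 0) + if v = k then 1 else 0 := by
      intro v; rw [intDegree_shift hij h hk]; ring
    simp only [this, Finset.sum_sub_distrib, Finset.sum_add_distrib, Finset.sum_ite_eq',
      Finset.mem_univ, if_true]
    have := hG.2
    rw [Finset.sum_sub_distrib] at this
    linarith

/-! ### Moves of the JS chain -/

lemma jsMove_nonneg (d : Fin n → ℕ) (G : SimpleGraph (Fin n)) (i j : Fin n)
    (G' : SimpleGraph (Fin n)) : 0 ≤ jsMove d G i j G' := by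
  unfold jsMove
  split_ifs <;> positivity

lemma sum_state_ite {K : SimpleGraph (Fin n)} (hK : IsNearRealization d K) (c : ℝ) :
    ∑ G' : JSState d, (if G'.1 = K then c else 0) = c := by
  rw [Finset.sum_eq_single ⟨K, hK⟩]
  · simp
  · intro b _ hb
    rw [if_neg]
    intro h
    exact hb (Subtype.ext h)
  · simp

lemma jsMove_of_delete {G : SimpleGraph (Fin n)} {i j : Fin n} (hG : IsRealization d G)
    (h : G.Adj i j) (G' : SimpleGraph (Fin n)) :
    jsMove d G i j G' = if G' = G \ edge i j then 1 else 0 := by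
  unfold jsMove
  rw [if_pos ⟨hG, h⟩]; rfl

lemma degree_lt_iff {G : SimpleGraph (Fin n)} {i : Fin n} [Fintype (G.neighborSet i)] {m : ℕ} :
    G.degree i < m ↔ intDegree G i < m := by
  rw [← degree_eq_intDegree]; norm_cast

lemma lt_degree_iff {G : SimpleGraph (Fin n)} {i : Fin n} [Fintype (G.neighborSet i)] {m : ℕ} :
    m < G.degree i ↔ m < intDegree G i := by
  rw [← degree_eq_intDegree]; norm_cast

lemma jsMove_of_add {G : SimpleGraph (Fin n)} {i j : Fin n} (hG : ¬ IsRealization d G)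
    (hij : i ≠ j) (h : ¬ G.Adj i j) (hi : intDegree G i < d i) (hj : intDegree G j < d j)
    (G' : SimpleGraph (Fin n)) :
    jsMove d G i j G' = if G' = G ⊔ edge i j then 1 else 0 := by
  unfold jsMove
  rw [if_neg (fun h => hG h.1), if_pos ⟨hG, degree_lt_iff.2 hi, h⟩, if_neg]
  rw [lt_degree_iff, intDegree_sup_edge hij h]
  simp [hij.symm]
  linarith

lemma jsMove_of_shift {G : SimpleGraph (Fin n)} {i j : Fin n} (hG : ¬ IsRealization d G)
    (hij : i ≠ j) (h : ¬ G.Adj i j) (hi : intDegree G i < d i) (hj : intDegree G j = d j)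
    (G' : SimpleGraph (Fin n)) :
    jsMove d G i j G' = ∑ k, if (G ⊔ edge i j).Adj j k ∧ G' = (G ⊔ edge i j) \ edge j k
      then 1 / ((d j : ℝ) + 1) else 0 := by
  have hd : intDegree (G ⊔ edge i j) j = d j + 1 := by
    rw [intDegree_sup_edge hij h]; simp [hij.symm, hj]
  unfold jsMove
  rw [if_neg (fun h => hG h.1), if_pos ⟨hG, degree_lt_iff.2 hi, h⟩, if_pos]
  · have hd' : ((G ⊔ edge i j).degree j : ℝ) = d j + 1 := by
      have := degree_eq_intDegree (G ⊔ edge i j) j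
      rw [hd] at this
      exact_mod_cast this
    rw [hd', ← Finset.sum_filter_add_sum_filter_not Finset.univ
      (fun k => (G ⊔ edge i j).Adj j k)]
    rw [Finset.sum_eq_zero (s := Finset.univ.filter fun k => ¬ (G ⊔ edge i j).Adj j k), add_zero]
    · refine Finset.sum_congr ?_ fun k hk => ?_
      · ext; simp
      · have : (G ⊔ edge i j).Adj j k := by simpa using hk
        simp only [this, true_and]; rfl
    · intro k hk
      rw [if_neg]
      simp at hk
      intro h
      simp [hk] at h
  · rw [lt_degree_iff, hd]; linarith

lemma jsMove_of_stay {G : SimpleGraph (Fin n)} {i j : Fin n}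
    (h1 : ¬ (IsRealization d G ∧ G.Adj i j))
    (h2 : ¬ (¬ IsRealization d G ∧ intDegree G i < d i ∧ ¬ G.Adj i j)) (G' : SimpleGraph (Fin n)) :
    jsMove d G i j G' = if G' = G then 1 else 0 := by
  unfold jsMove
  rw [if_neg h1, if_neg]
  rwa [degree_lt_iff]

/-- The four kinds of moves of the JS chain. -/
lemma jsMove_cases (G : JSState d) (i j : Fin n) :
    (IsRealization d G.1 ∧ G.1.Adj i j) ∨
    (¬ IsRealization d G.1 ∧ ¬ G.1.Adj i j ∧ intDegree G.1 i < d i ∧ intDegree G.1 j < d j) ∨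
    (¬ IsRealization d G.1 ∧ ¬ G.1.Adj i j ∧ intDegree G.1 i < d i ∧ intDegree G.1 j = d j) ∨
    (¬ (IsRealization d G.1 ∧ G.1.Adj i j) ∧
      ¬ (¬ IsRealization d G.1 ∧ intDegree G.1 i < d i ∧ ¬ G.1.Adj i j)) := by
  have := (isNearRealization_iff.1 G.2).1 j
  rcases this.lt_or_eq with h | h <;> tauto

lemma sum_jsMove (G : JSState d) {i j : Fin n} (hij : i ≠ j) :
    ∑ G' : JSState d, jsMove d G.1 i j G'.1 = 1 := by
  rcases jsMove_cases G i j with ⟨hG, h⟩ | ⟨hG, h, hi, hj⟩ | ⟨hG, h, hi, hj⟩ | ⟨h1, h2⟩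
  · simp only [jsMove_of_delete hG h]
    exact sum_state_ite (isNearRealization_sdiff hG h) 1
  · simp only [jsMove_of_add hG hij h hi hj]
    exact sum_state_ite (isRealization_sup G.2 hij h hi hj).isNearRealization 1
  · simp only [jsMove_of_shift hG hij h hi hj]
    rw [Finset.sum_comm]
    have : ∀ k, ∑ G' : JSState d, (if (G.1 ⊔ edge i j).Adj j k ∧
        G'.1 = (G.1 ⊔ edge i j) \ edge j k then 1 / ((d j : ℝ) + 1) else 0)
        = (if (G.1 ⊔ edge i j).Adj j k then 1 else 0) * (1 / ((d j : ℝ) + 1)) := by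
      intro k
      by_cases hk : (G.1 ⊔ edge i j).Adj j k
      · simp only [hk, true_and, if_true, one_mul]
        exact sum_state_ite (isNearRealization_shift G.2 hij h hi hk) _
      · simp [hk]
    simp only [this, ← Finset.sum_mul]
    have hd : intDegree (G.1 ⊔ edge i j) j = d j + 1 := by
      rw [intDegree_sup_edge hij h]; simp [hij.symm, hj]
    have hd' : (∑ k, if (G.1 ⊔ edge i j).Adj j k then (1 : ℝ) else 0) = d j + 1 := by
      unfold intDegree at hd
      exact_mod_cast hd
    rw [hd']
    field_simp
  · simp only [jsMove_of_stay h1 h2]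
    exact sum_state_ite G.2 1

/-! ### Symmetry of the transition matrix -/

/-- The indicator of the event that deleting `ij` leads from the realization `G` to `G'`. -/
def deleteMove (d : Fin n → ℕ) (G G' : SimpleGraph (Fin n)) (i j : Fin n) : ℝ :=
  if IsRealization d G ∧ G.Adj i j ∧ G' = G \ edge i j then 1 else 0

/-- The probability that adding `ij` and deleting `jk` leads from `G` to `G'`. -/
def shiftMove (d : Fin n → ℕ) (G G' : SimpleGraph (Fin n)) (i j k : Fin n) : ℝ :=
  if ¬ IsRealization d G ∧ ¬ G.Adj i j ∧ i ≠ j ∧ intDegree G i < d i ∧ intDegree G j = d j ∧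
    (G ⊔ edge i j).Adj j k ∧ G' = (G ⊔ edge i j) \ edge j k then 1 / ((d j : ℝ) + 1) else 0

lemma not_isRealization_of_lt {G : SimpleGraph (Fin n)} {i : Fin n} (h : intDegree G i < d i) :
    ¬ IsRealization d G := fun hG => by
  have := isRealization_iff.1 hG i
  linarith

lemma intDegree_lt_of_sdiff {G : SimpleGraph (Fin n)} {i j : Fin n} (hG : IsRealization d G)
    (h : G.Adj i j) :
    intDegree (G \ edge i j) i < d i ∧ intDegree (G \ edge i j) j < d j := by
  rw [isRealization_iff] at hG
  constructor
  · rw [intDegree_sdiff_edge h, hG i]; simp [h.ne]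
  · rw [intDegree_sdiff_edge h, hG j]; simp [h.ne.symm]

/-- This form makes symmetry visible: an insertion that produces a realization is the deletion of
the same edge read from `G'` to `G`, so the first two terms are exchanged when `G` and `G'` are, and
only the shift terms need an argument. -/
lemma jsMove_eq {G G' : JSState d} (hne : G ≠ G') {i j : Fin n} (hij : i ≠ j) :
    jsMove d G.1 i j G'.1
      = deleteMove d G.1 G'.1 i j + deleteMove d G'.1 G.1 i j
        + ∑ k, shiftMove d G.1 G'.1 i j k := by
  have hne' : ¬ G'.1 = G.1 := fun h => hne (Subtype.ext h.symm)
  rcases jsMove_cases G i j with ⟨hG, h⟩ | ⟨hG, h, hi, hj⟩ | ⟨hG, h, hi, hj⟩ | ⟨h1, h2⟩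
  · have e1 : ¬ (IsRealization d G'.1 ∧ G'.1.Adj i j ∧ G.1 = G'.1 \ edge i j) := fun h' => by
      have := (intDegree_lt_of_sdiff h'.1 h'.2.1).1
      rw [← h'.2.2] at this
      exact not_isRealization_of_lt this hG
    have e2 : ∀ k, shiftMove d G.1 G'.1 i j k = 0 := fun k => if_neg fun h' => h'.1 hG
    simp only [e1, e2, jsMove_of_delete hG h, deleteMove, hG, h, true_and, Finset.sum_const_zero,
      add_zero, if_false]
  · have e2 : ∀ k, shiftMove d G.1 G'.1 i j k = 0 := fun k => if_neg fun h' => by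
      have := h'.2.2.2.2.1
      linarith
    simp only [e2, jsMove_of_add hG hij h hi hj, deleteMove, Finset.sum_const_zero, add_zero,
      zero_add, hG, false_and, if_false]
    congr 1
    apply propext
    constructor
    · intro h'
      rw [h']
      exact ⟨isRealization_sup G.2 hij h hi hj, by simp [edge_adj, hij], (sup_sdiff_edge h).symm⟩
    · rintro ⟨_, h2, h3⟩
      rw [h3, sdiff_sup_edge h2]
  · have e1 : deleteMove d G.1 G'.1 i j = 0 := if_neg fun h' => hG h'.1
    have e2 : deleteMove d G'.1 G.1 i j = 0 := if_neg fun h' => by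
      have := (intDegree_lt_of_sdiff h'.1 h'.2.1).2
      rw [← h'.2.2] at this
      linarith
    rw [e1, e2, jsMove_of_shift hG hij h hi hj]
    simp only [shiftMove, hG, h, hij, hi, hj, not_false_eq_true, ne_eq, true_and, zero_add]
  · have e1 : deleteMove d G.1 G'.1 i j = 0 := if_neg fun h' => h1 ⟨h'.1, h'.2.1⟩
    have e2 : deleteMove d G'.1 G.1 i j = 0 := if_neg fun h' => by
      have := (intDegree_lt_of_sdiff h'.1 h'.2.1).1
      have h3 := not_adj_sdiff_edge G'.1 i j
      rw [← h'.2.2] at this h3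
      exact h2 ⟨not_isRealization_of_lt this, this, h3⟩
    have e3 : ∀ k, shiftMove d G.1 G'.1 i j k = 0 := fun k => if_neg fun h' =>
      h2 ⟨h'.1, h'.2.2.2.1, h'.2.1⟩
    simp only [e1, e2, e3, jsMove_of_stay h1 h2, hne', if_false, Finset.sum_const_zero, add_zero]

/-- The shift that adds ij and deletes jk is undone by the shift that adds kj and deletes ji. The
middle node j is saturated before and after, so both choose among `d j + 1` edges and have the same
probability. -/
lemma shiftMove_symm_aux {G G' : SimpleGraph (Fin n)} (hne : G ≠ G') {i j k : Fin n}
    (h : ¬ IsRealization d G ∧ ¬ G.Adj i j ∧ i ≠ j ∧ intDegree G i < d i ∧ intDegree G j = d j ∧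
      (G ⊔ edge i j).Adj j k ∧ G' = (G ⊔ edge i j) \ edge j k) (hk : intDegree G k ≤ d k) :
    ¬ IsRealization d G' ∧ ¬ G'.Adj k j ∧ k ≠ j ∧ intDegree G' k < d k ∧ intDegree G' j = d j ∧
      (G' ⊔ edge k j).Adj j i ∧ G = (G' ⊔ edge k j) \ edge j i := by
  obtain ⟨_, h1, hij, hi, hj, hjk, rfl⟩ := h
  have hki : k ≠ i := by
    rintro rfl
    apply hne
    rw [edge_comm j k, sup_sdiff_edge h1]
  have hlt : intDegree ((G ⊔ edge i j) \ edge j k) k < d k := by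
    rw [intDegree_shift hij h1 hjk]
    simp [hki]
    linarith
  have e : (G ⊔ edge i j) \ edge j k ⊔ edge k j = G ⊔ edge i j := by
    rw [edge_comm k j, sdiff_sup_edge hjk]
  refine ⟨not_isRealization_of_lt hlt, ?_, hjk.ne.symm, hlt, ?_, ?_, ?_⟩
  · rw [SimpleGraph.adj_comm]; exact not_adj_sdiff_edge _ j k
  · rw [intDegree_shift hij h1 hjk, hj]; simp [hij.symm, hjk.ne]
  · rw [e]; simp [edge_adj, hij.symm]
  · rw [e, edge_comm j i, sup_sdiff_edge h1]

lemma shiftMove_symm {G G' : JSState d} (hne : G ≠ G') (i j k : Fin n) :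
    shiftMove d G.1 G'.1 i j k = shiftMove d G'.1 G.1 k j i := by
  unfold shiftMove
  congr 1
  apply propext
  have hne' : G.1 ≠ G'.1 := fun h => hne (Subtype.ext h)
  exact ⟨fun h => shiftMove_symm_aux hne' h ((isNearRealization_iff.1 G.2).1 k),
    fun h => shiftMove_symm_aux hne'.symm h ((isNearRealization_iff.1 G'.2).1 i)⟩

lemma sum_offDiag_shiftMove (G G' : SimpleGraph (Fin n)) :
    ∑ e ∈ (Finset.univ : Finset (Fin n)).offDiag, ∑ k, shiftMove d G G' e.1 e.2 k
      = ∑ j, ∑ i, ∑ k, shiftMove d G G' i j k := by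
  rw [Finset.sum_comm (f := fun j i => ∑ k, shiftMove d G G' i j k),
    ← Fintype.sum_prod_type' (f := fun i j => ∑ k, shiftMove d G G' i j k)]
  refine Finset.sum_subset (Finset.subset_univ _) ?_
  · rintro ⟨i, j⟩ _ h
    refine Finset.sum_eq_zero fun k _ => if_neg fun h' => h ?_
    simpa using h'.2.2.1

lemma sum_jsMove_symm {G G' : JSState d} (hne : G ≠ G') :
    ∑ e ∈ (Finset.univ : Finset (Fin n)).offDiag, jsMove d G.1 e.1 e.2 G'.1
      = ∑ e ∈ (Finset.univ : Finset (Fin n)).offDiag, jsMove d G'.1 e.1 e.2 G.1 := by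
  rw [Finset.sum_congr rfl fun e he => jsMove_eq hne (Finset.mem_offDiag.1 he).2.2,
    Finset.sum_congr rfl fun e he => jsMove_eq hne.symm (Finset.mem_offDiag.1 he).2.2]
  simp only [Finset.sum_add_distrib]
  rw [sum_offDiag_shiftMove, sum_offDiag_shiftMove]
  congr 1
  · ring
  · refine Finset.sum_congr rfl fun j _ => ?_
    rw [Finset.sum_comm]
    exact Finset.sum_congr rfl fun k _ => Finset.sum_congr rfl fun i _ =>
      shiftMove_symm hne i j k

lemma jsP_symm (G G' : JSState d) : jsP d G G' = jsP d G' G := by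
  by_cases hne : G = G'
  · rw [hne]
  · unfold jsP
    rw [← Finset.mul_sum, ← Finset.mul_sum, sum_jsMove_symm hne, if_neg hne,
      if_neg (fun h => hne h.symm)]

lemma pairProb_nonneg (n : ℕ) : 0 ≤ 1 / ((n : ℝ) * ((n : ℝ) - 1)) := by
  rcases Nat.eq_zero_or_pos n with rfl | h
  · simp
  · have : (1 : ℝ) ≤ n := by exact_mod_cast h
    have : 0 ≤ (n : ℝ) - 1 := by linarith
    positivity

lemma jsP_nonneg (G G' : JSState d) : 0 ≤ jsP d G G' := by
  unfold jsP
  have h := pairProb_nonneg n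
  have h2 : 0 ≤ ∑ e ∈ (Finset.univ : Finset (Fin n)).offDiag,
      1 / ((n : ℝ) * ((n : ℝ) - 1)) * jsMove d G.1 e.1 e.2 G'.1 :=
    Finset.sum_nonneg fun e _ => mul_nonneg h (jsMove_nonneg _ _ _ _ _)
  split_ifs <;> linarith

lemma jsP_row_sum (hn : 1 < n) (G : JSState d) : ∑ G', jsP d G G' = 1 := by
  unfold jsP
  rw [Finset.sum_add_distrib, ← Finset.mul_sum, ← Finset.mul_sum, Finset.sum_comm,
    Finset.sum_ite_eq']
  rw [Finset.sum_congr rfl (g := fun _ => 1 / ((n : ℝ) * ((n : ℝ) - 1)))]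
  · rw [Finset.sum_const, Finset.offDiag_card, Finset.card_univ, Fintype.card_fin, nsmul_eq_mul]
    have h1 : (1 : ℝ) < n := by exact_mod_cast hn
    have h2 : (n : ℝ) - 1 ≠ 0 := by linarith
    have h3 : (n : ℝ) ≠ 0 := by linarith
    rw [Nat.cast_sub (by nlinarith)]
    push_cast
    have : (n : ℝ) * n - n = n * (n - 1) := by ring
    rw [this, mul_one_div_cancel (mul_ne_zero h3 h2)]
    norm_num
  · intro e he
    rw [← Finset.mul_sum, sum_jsMove G (Finset.mem_offDiag.1 he).2.2, mul_one]

lemma isReversibleChain_jsP (hn : 1 < n) {G : SimpleGraph (Fin n)} (hG : IsRealization d G) :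
    IsReversibleChain (jsP d) (uniformDist (JSState d)) where
  nonneg := jsP_nonneg
  row_sum := jsP_row_sum hn
  dist_nonneg _ := by unfold uniformDist; positivity
  dist_sum := by
    have : Nonempty (JSState d) := ⟨⟨G, hG.isNearRealization⟩⟩
    have : (Fintype.card (JSState d) : ℝ) ≠ 0 := by exact_mod_cast Fintype.card_ne_zero
    simp [uniformDist, Finset.card_univ, this]
  detailed_balance x y := by rw [jsP_symm]; rfl

/-! ### Arcs of the state space graph -/

lemma IsArc.symm {G G' : JSState d} (h : IsArc (jsP d) G G') : IsArc (jsP d) G' G :=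
  ⟨h.1.symm, by rw [jsP_symm]; exact h.2⟩

lemma jsP_ge {G G' : JSState d} {i j : Fin n} (hij : i ≠ j) :
    1 / 2 * (1 / ((n : ℝ) * ((n : ℝ) - 1)) * jsMove d G.1 i j G'.1) ≤ jsP d G G' := by
  unfold jsP
  have h := pairProb_nonneg n
  have h2 : 1 / ((n : ℝ) * ((n : ℝ) - 1)) * jsMove d G.1 i j G'.1 ≤
      ∑ e ∈ (Finset.univ : Finset (Fin n)).offDiag,
        1 / ((n : ℝ) * ((n : ℝ) - 1)) * jsMove d G.1 e.1 e.2 G'.1 :=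
    Finset.single_le_sum
      (f := fun e : Fin n × Fin n => 1 / ((n : ℝ) * ((n : ℝ) - 1)) * jsMove d G.1 e.1 e.2 G'.1)
      (fun e _ => mul_nonneg h (jsMove_nonneg _ _ _ _ _))
      (show (i, j) ∈ Finset.univ.offDiag by simpa using hij)
  split_ifs <;> linarith

lemma isArc_of_jsMove {G G' : JSState d} {i j : Fin n} (hij : i ≠ j) (hne : G ≠ G')
    (h : 0 < jsMove d G.1 i j G'.1) : IsArc (jsP d) G G' := by
  refine ⟨hne, lt_of_lt_of_le ?_ (jsP_ge hij)⟩
  have : 1 < n := by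
    have h1 := i.2
    have h2 := j.2
    have h3 : i.1 ≠ j.1 := fun h => hij (Fin.ext h)
    omega
  have h1 : (1 : ℝ) < n := by exact_mod_cast this
  have h2 : 0 < (n : ℝ) - 1 := by linarith
  positivity

lemma isArc_delete {G G' : JSState d} {i j : Fin n} (hG : IsRealization d G.1)
    (h : G.1.Adj i j) (hG' : G'.1 = G.1 \ edge i j) : IsArc (jsP d) G G' := by
  refine isArc_of_jsMove h.ne ?_ (i := i) (j := j) ?_
  · rintro rfl
    exact not_adj_sdiff_edge G.1 i j (hG' ▸ h)
  · rw [jsMove_of_delete hG h, if_pos hG']; norm_num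

lemma isArc_shift {G G' : JSState d} {i j k : Fin n} (hij : i ≠ j) (h : ¬ G.1.Adj i j)
    (hi : intDegree G.1 i < d i) (hj : intDegree G.1 j = d j) (hk : (G.1 ⊔ edge i j).Adj j k)
    (hki : k ≠ i) (hG' : G'.1 = (G.1 ⊔ edge i j) \ edge j k) : IsArc (jsP d) G G' := by
  refine isArc_of_jsMove hij ?_ (i := i) (j := j) ?_
  · rintro rfl
    have := intDegree_shift hij h hk i
    rw [← hG'] at this
    simp [hki.symm] at this
  · rw [jsMove_of_shift (not_isRealization_of_lt hi) hij h hi hj]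
    refine lt_of_lt_of_le ?_ (Finset.single_le_sum (fun k _ => by split_ifs <;> positivity)
      (Finset.mem_univ k))
    rw [if_pos ⟨hk, hG'⟩]
    positivity

lemma exists_jsMove_of_isArc {G G' : JSState d} (h : IsArc (jsP d) G G') :
    ∃ i j, i ≠ j ∧ 0 < jsMove d G.1 i j G'.1 := by
  by_contra! hcon
  have : jsP d G G' = 0 := by
    unfold jsP
    rw [if_neg (fun e => h.1 e.symm), Finset.sum_eq_zero]
    · simp
    · intro e he
      rw [le_antisymm (hcon e.1 e.2 (Finset.mem_offDiag.1 he).2.2) (jsMove_nonneg _ _ _ _ _),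
        mul_zero]
  exact h.2.ne' this

/-- A move between distinct states toggles at most two edges with a common end node, and its
probability is at least `1 / n`. -/
lemma jsMove_pos {G G' : JSState d} (hne : G ≠ G') {i j : Fin n} (hij : i ≠ j)
    (h : 0 < jsMove d G.1 i j G'.1) :
    (∃ k, G'.1 = (G.1 ∆ edge i j) ∆ edge j k) ∧ 1 / (n : ℝ) ≤ jsMove d G.1 i j G'.1 := by
  have hn : (1 : ℝ) ≤ n := by exact_mod_cast i.pos
  have hn1 : 1 / (n : ℝ) ≤ 1 := by rw [div_le_one (by linarith)]; exact hn
  have hne' : ¬ G'.1 = G.1 := fun h => hne (Subtype.ext h.symm)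
  have hsup : ¬ G.1.Adj i j → G.1 ⊔ edge i j = G.1 ∆ edge i j := fun hh =>
    ((G.1.disjoint_edge).2 hh).symmDiff_eq_sup.symm
  have hsd : ∀ {K : SimpleGraph (Fin n)} {a b : Fin n}, K.Adj a b → K \ edge a b = K ∆ edge a b :=
    fun hh => (symmDiff_of_ge ((edge_le_iff _).2 (Or.inr hh))).symm
  rcases jsMove_cases G i j with ⟨hG, ha⟩ | ⟨hG, ha, hi, hj⟩ | ⟨hG, ha, hi, hj⟩ | ⟨h1, h2⟩
  · rw [jsMove_of_delete hG ha] at h ⊢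
    split_ifs at h ⊢ with hh
    -- Only one edge changes here; the second one is the dummy `edge j j`, which is empty.
    · exact ⟨⟨j, by rw [hh, hsd ha, edge_self_eq_bot, symmDiff_bot]⟩, hn1⟩
    · exact absurd h (lt_irrefl _)
  · rw [jsMove_of_add hG hij ha hi hj] at h ⊢
    split_ifs at h ⊢ with hh
    · exact ⟨⟨j, by rw [hh, hsup ha, edge_self_eq_bot, symmDiff_bot]⟩, hn1⟩
    · exact absurd h (lt_irrefl _)
  · rw [jsMove_of_shift hG hij ha hi hj] at h ⊢
    obtain ⟨k, hk⟩ : ∃ k, (G.1 ⊔ edge i j).Adj j k ∧ G'.1 = (G.1 ⊔ edge i j) \ edge j k := by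
      by_contra! hcon
      rw [Finset.sum_eq_zero] at h
      · exact lt_irrefl _ h
      · intro k _
        rw [if_neg]
        rintro ⟨a, b⟩
        exact hcon k a b
    refine ⟨⟨k, by rw [hk.2, hsd hk.1, hsup ha]⟩, ?_⟩
    refine le_trans ?_ (Finset.single_le_sum (fun k _ => by split_ifs <;> positivity)
      (Finset.mem_univ k))
    rw [if_pos hk]
    have hd : intDegree (G.1 ⊔ edge i j) j = d j + 1 := by
      rw [intDegree_sup_edge hij ha]; simp [hij.symm, hj]
    have := intDegree_le (G.1 ⊔ edge i j) j
    rw [hd] at this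
    have : (d j : ℝ) + 1 ≤ n := by exact_mod_cast this
    exact one_div_le_one_div_of_le (by positivity) this
  · rw [jsMove_of_stay h1 h2, if_neg hne'] at h
    exact absurd h (lt_irrefl _)

/-- The factors are 2 for laziness, n(n-1) for the choice of the pair, and at most n for the choice
of the edge to delete. -/
lemma one_div_jsP_le {G G' : JSState d} (h : IsArc (jsP d) G G') :
    1 / jsP d G G' ≤ 2 * (n : ℝ) ^ 3 := by
  obtain ⟨i, j, hij, hm⟩ := exists_jsMove_of_isArc h
  have h1 := (jsMove_pos h.1 hij hm).2
  have h2 := jsP_ge (G := G) (G' := G') hij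
  have : 1 < n := by
    have h1 := i.2
    have h2 := j.2
    have h3 : i.1 ≠ j.1 := fun h => hij (Fin.ext h)
    omega
  have hn : (1 : ℝ) < n := by exact_mod_cast this
  have hn' : 0 < (n : ℝ) - 1 := by linarith
  have h3 : 1 / (2 * (n : ℝ) ^ 3) ≤ jsP d G G' := by
    refine le_trans ?_ h2
    calc 1 / (2 * (n : ℝ) ^ 3) = 1 / 2 * (1 / ((n : ℝ) * n) * (1 / n)) := by field_simp
      _ ≤ 1 / 2 * (1 / ((n : ℝ) * (n - 1)) * (1 / n)) := by
        gcongr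
        linarith
      _ ≤ _ := by gcongr
  rw [one_div_le h.2 (by positivity)]
  exact h3

lemma log_card_state_le : Real.log (Fintype.card (JSState d) : ℝ) ≤ (n : ℝ) ^ 2 := by
  have h1 : Fintype.card (JSState d) ≤ 2 ^ (n ^ 2) := by
    have : Function.Injective
        (fun G : JSState d => fun p : Fin n × Fin n => decide (G.1.Adj p.1 p.2)) := by
      intro G G' h
      refine Subtype.ext (SimpleGraph.ext ?_)
      ext a b
      simpa using congrFun h (a, b)
    have := Fintype.card_le_of_injective _ this
    simpa [sq] using this
  rcases Nat.eq_zero_or_pos (Fintype.card (JSState d)) with h0 | h0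
  · rw [h0]; simp
  · calc Real.log (Fintype.card (JSState d) : ℝ) ≤ Real.log ((2 : ℝ) ^ (n ^ 2)) := by
          apply Real.log_le_log (by exact_mod_cast h0)
          exact_mod_cast h1
      _ = (n : ℝ) ^ 2 * Real.log 2 := by rw [Real.log_pow]; push_cast; ring
      _ ≤ (n : ℝ) ^ 2 * 1 := by
          gcongr
          linarith [Real.log_two_lt_d9]
      _ = _ := mul_one _

/-! ### Pairings of the edges at a node -/

section VertexPairings

variable {α : Type*} [Fintype α]

/-- The involutions of `N` (extended by the identity) that exchange the two colour classes of the
colouring `c` of `N`. -/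
def vertexPairings (N : Finset α) (c : α → Prop) : Finset (Equiv.Perm α) :=
  Finset.univ.filter fun σ => (∀ a, σ (σ a) = a) ∧
    ∀ a, (a ∉ N → σ a = a) ∧ (a ∈ N → σ a ∈ N ∧ (c (σ a) ↔ ¬ c a))

lemma mem_vertexPairings {N : Finset α} {c : α → Prop} {σ : Equiv.Perm α} :
    σ ∈ vertexPairings N c ↔ (∀ a, σ (σ a) = a) ∧
      ∀ a, (a ∉ N → σ a = a) ∧ (a ∈ N → σ a ∈ N ∧ (c (σ a) ↔ ¬ c a)) := by
  simp [vertexPairings]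

lemma card_colour_eq {N : Finset α} {c : α → Prop} {σ : Equiv.Perm α}
    (h : σ ∈ vertexPairings N c) :
    (N.filter c).card = (N.filter fun a => ¬ c a).card := by
  rw [mem_vertexPairings] at h
  refine Finset.card_bij' (fun a _ => σ a) (fun a _ => σ a) ?_ ?_ ?_ ?_
  · intro a ha
    rw [Finset.mem_filter] at ha ⊢
    have := (h.2 a).2 ha.1
    tauto
  · intro a ha
    rw [Finset.mem_filter] at ha ⊢
    have := (h.2 a).2 ha.1
    tauto
  · intro a _; exact h.1 a
  · intro a _; exact h.1 a

lemma card_eq_two_mul_of_colour {β : Type*} {N : Finset β} {c : β → Prop}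
    (h : (N.filter c).card = (N.filter fun a => ¬ c a).card) :
    N.card / 2 = (N.filter c).card := by
  have := Finset.card_filter_add_card_filter_not (s := N) c
  omega

/-- Such an involution is determined by its restriction to one colour class, an injection into the
other class. If there is any such involution at all, the two classes have the same size. -/
lemma card_vertexPairings_le (N : Finset α) (c : α → Prop) :
    (vertexPairings N c).card ≤ (N.card / 2).factorial := by
  rcases (vertexPairings N c).eq_empty_or_nonempty with h0 | ⟨σ₀, h₀⟩
  · simp [h0]
  have hc := card_colour_eq h₀
  rw [card_eq_two_mul_of_colour hc]
  let A := N.filter c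
  let B := N.filter fun a => ¬ c a
  have hAB : ∀ σ ∈ vertexPairings N c, ∀ a ∈ A, σ a ∈ B := by
    intro σ hσ a ha
    rw [Finset.mem_filter] at ha ⊢
    have := ((mem_vertexPairings.1 hσ).2 a).2 ha.1
    tauto
  let F : vertexPairings N c → (A ↪ B) := fun σ =>
    ⟨fun a => ⟨σ.1 a.1, hAB σ.1 σ.2 a.1 a.2⟩, fun _ _ hab =>
      Subtype.ext (σ.1.injective (congrArg Subtype.val hab))⟩
  have hF : Function.Injective F := by
    intro σ τ h
    have hA : ∀ a ∈ A, σ.1 a = τ.1 a := fun a ha => by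
      have := congrArg (fun e : A ↪ B => (e ⟨a, ha⟩).1) h
      exact this
    refine Subtype.ext (Equiv.ext fun a => ?_)
    have hσ := mem_vertexPairings.1 σ.2
    have hτ := mem_vertexPairings.1 τ.2
    by_cases haN : a ∈ N
    · by_cases hca : c a
      · exact hA a (Finset.mem_filter.2 ⟨haN, hca⟩)
      · have h1 := (hσ.2 a).2 haN
        have h2 := hA (σ.1 a) (Finset.mem_filter.2 ⟨h1.1, h1.2.2 hca⟩)
        rw [hσ.1] at h2
        rw [h2, hτ.1, ← h2]
    · rw [(hσ.2 a).1 haN, (hτ.2 a).1 haN]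
  have := Fintype.card_le_of_injective F hF
  rw [Fintype.card_embedding_eq, Fintype.card_coe, Fintype.card_coe, Fintype.card_coe] at this
  rwa [show B.card = A.card from hc.symm, Nat.descFactorial_self] at this

/-- Conversely, each bijection between the colour classes extends to an involution, acting by its
inverse on the second class and trivially elsewhere. -/
lemma card_vertexPairings_ge (N : Finset α) (c : α → Prop)
    (hc : (N.filter c).card = (N.filter fun a => ¬ c a).card) :
    (N.card / 2).factorial ≤ (vertexPairings N c).card := by
  rw [card_eq_two_mul_of_colour hc]
  let A := N.filter c
  let B := N.filter fun a => ¬ c a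
  have hA : ∀ {a}, a ∈ A ↔ a ∈ N ∧ c a := Finset.mem_filter
  have hB : ∀ {a}, a ∈ B ↔ a ∈ N ∧ ¬ c a := Finset.mem_filter
  have hd : ∀ a, a ∈ B → a ∉ A := fun a ha ha' => (hB.1 ha).2 (hA.1 ha').2
  let f : (A ≃ B) → α → α := fun e a =>
    if h : a ∈ A then (e ⟨a, h⟩).1 else if h : a ∈ B then (e.symm ⟨a, h⟩).1 else a
  have fA : ∀ e a (h : a ∈ A), f e a = (e ⟨a, h⟩).1 := fun e a h => dif_pos h
  have fB : ∀ e a (h : a ∈ B), f e a = (e.symm ⟨a, h⟩).1 := fun e a h => by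
    simp only [f]
    rw [dif_neg (hd a h), dif_pos h]
  have fN : ∀ e a, a ∉ A → a ∉ B → f e a = a := fun e a h h' => by
    simp only [f]
    rw [dif_neg h, dif_neg h']
  have finv : ∀ e, Function.Involutive (f e) := by
    intro e a
    by_cases h : a ∈ A
    · rw [fA e a h, fB e _ (e ⟨a, h⟩).2]; simp
    · by_cases h' : a ∈ B
      · rw [fB e a h', fA e _ (e.symm ⟨a, h'⟩).2]; simp
      · rw [fN e a h h', fN e a h h']
  let F : (A ≃ B) → vertexPairings N c := fun e => ⟨(finv e).toPerm, by
    rw [mem_vertexPairings]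
    refine ⟨finv e, fun a => ⟨fun ha => fN e a (fun h => ha (hA.1 h).1) (fun h => ha (hB.1 h).1),
      fun ha => ?_⟩⟩
    show f e a ∈ N ∧ (c (f e a) ↔ ¬ c a)
    by_cases hca : c a
    · rw [fA e a (hA.2 ⟨ha, hca⟩)]
      have := hB.1 (e ⟨a, hA.2 ⟨ha, hca⟩⟩).2
      tauto
    · rw [fB e a (hB.2 ⟨ha, hca⟩)]
      have := hA.1 (e.symm ⟨a, hB.2 ⟨ha, hca⟩⟩).2
      tauto⟩
  have hF : Function.Injective F := by
    intro e e' h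
    refine Equiv.ext fun a => Subtype.ext ?_
    have := congrArg (fun σ : vertexPairings N c => σ.1 a.1) h
    have h2 : f e a.1 = f e' a.1 := this
    rwa [fA e a.1 a.2, fA e' a.1 a.2] at h2
  have := Fintype.card_le_of_injective F hF
  have e0 : A ≃ B := Fintype.equivOfCardEq (by simpa using hc)
  rw [Fintype.card_equiv e0, Fintype.card_coe, Fintype.card_coe] at this
  exact this

end VertexPairings

/-- The families of pairings of the edges of `D` at all nodes that respect the colouring `c` of the
half-edges: `c b a` is the colour of the edge `ba` as seen from `b`. -/
def pairings (D : SimpleGraph (Fin n)) (c : Fin n → Fin n → Prop) :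
    Finset (Fin n → Equiv.Perm (Fin n)) :=
  Fintype.piFinset fun b => vertexPairings (Finset.univ.filter (D.Adj b)) (c b)

lemma mem_pairings {D : SimpleGraph (Fin n)} {c : Fin n → Fin n → Prop}
    {σ : Fin n → Equiv.Perm (Fin n)} :
    σ ∈ pairings D c ↔ ∀ b, (∀ a, σ b (σ b a) = a) ∧
      ∀ a, (¬ D.Adj b a → σ b a = a) ∧ (D.Adj b a → D.Adj b (σ b a) ∧ (c b (σ b a) ↔ ¬ c b a)) := by
  simp [pairings, mem_vertexPairings]

/-- The number of pairings of a balanced colouring of `D`. -/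
def pairingCount (D : SimpleGraph (Fin n)) : ℕ :=
  ∏ b, ((Finset.univ.filter (D.Adj b)).card / 2).factorial

lemma pairingCount_pos (D : SimpleGraph (Fin n)) : 0 < pairingCount D :=
  Finset.prod_pos fun _ _ => Nat.factorial_pos _

lemma card_pairings_le (D : SimpleGraph (Fin n)) (c : Fin n → Fin n → Prop) :
    (pairings D c).card ≤ pairingCount D := by
  unfold pairings pairingCount
  rw [Fintype.card_piFinset]
  exact Finset.prod_le_prod' fun b _ => card_vertexPairings_le _ _

lemma symmDiff_adj {G H : SimpleGraph (Fin n)} {a b : Fin n} :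
    (G ∆ H).Adj a b ↔ (G.Adj a b ↔ ¬ H.Adj a b) := by
  simp only [symmDiff_def, sup_adj, sdiff_adj]
  tauto

/-- `G` and `H` have equal degrees at every node; discarding the common edges leaves equally many
edges of each in the symmetric difference, so the colouring is balanced. -/
lemma card_pairings_realization {G H : SimpleGraph (Fin n)} (hG : IsRealization d G)
    (hH : IsRealization d H) : (pairings (G ∆ H) G.Adj).card = pairingCount (G ∆ H) := by
  refine le_antisymm (card_pairings_le _ _) ?_
  unfold pairings pairingCount
  rw [Fintype.card_piFinset]
  refine Finset.prod_le_prod' fun b _ => card_vertexPairings_ge _ _ ?_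
  have h : intDegree G b = intDegree H b := by
    rw [isRealization_iff.1 hG, isRealization_iff.1 hH]
  unfold intDegree at h
  rw [Finset.sum_boole, Finset.sum_boole] at h
  have h' : (Finset.univ.filter (G.Adj b)).card = (Finset.univ.filter (H.Adj b)).card := by
    exact_mod_cast h
  rw [← Finset.card_filter_add_card_filter_not (s := Finset.univ.filter (G.Adj b)) (H.Adj b),
    ← Finset.card_filter_add_card_filter_not (s := Finset.univ.filter (H.Adj b)) (G.Adj b)] at h'
  simp only [Finset.filter_filter] at h' ⊢
  have e1 : (Finset.univ.filter fun a => G.Adj b a ∧ H.Adj b a)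
      = Finset.univ.filter fun a => H.Adj b a ∧ G.Adj b a := by
    ext; simp [and_comm]
  have e2 : (Finset.univ.filter fun a => (G ∆ H).Adj b a ∧ G.Adj b a)
      = Finset.univ.filter fun a => G.Adj b a ∧ ¬ H.Adj b a := by
    ext; simp only [Finset.mem_filter, Finset.mem_univ, true_and, symmDiff_adj]; tauto
  have e3 : (Finset.univ.filter fun a => (G ∆ H).Adj b a ∧ ¬ G.Adj b a)
      = Finset.univ.filter fun a => H.Adj b a ∧ ¬ G.Adj b a := by
    ext; simp only [Finset.mem_filter, Finset.mem_univ, true_and, symmDiff_adj]; tauto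
  rw [e1] at h'
  rw [e2, e3]
  exact Nat.add_left_cancel h'

/-! ### The alternating circuits of a pairing -/

section Circuits

variable (σ : Fin n → Equiv.Perm (Fin n))

/-- The successor permutation of a family of pairings on the darts (ordered pairs of nodes): the
dart `(a, b)` is followed by the dart that leaves `b` along the partner of the edge `ba`. -/
def dartPerm : Equiv.Perm (Fin n × Fin n) where
  toFun p := (p.2, σ p.2 p.1)
  invFun p := ((σ p.1).symm p.2, p.1)
  left_inv p := by simp
  right_inv p := by simp

lemma dartPerm_apply (p : Fin n × Fin n) : dartPerm σ p = (p.2, σ p.2 p.1) := rfl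

/-- The `i`-th dart of the trail that starts with `q`. -/
def trailDart (q : Fin n × Fin n) (i : ℕ) : Fin n × Fin n := (dartPerm σ ^ i) q

lemma trailDart_zero (q : Fin n × Fin n) : trailDart σ q 0 = q := rfl

lemma trailDart_succ (q : Fin n × Fin n) (i : ℕ) :
    trailDart σ q (i + 1) = dartPerm σ (trailDart σ q i) := by
  unfold trailDart
  rw [pow_succ', Equiv.Perm.mul_apply]

lemma trailDart_succ_fst (q : Fin n × Fin n) (i : ℕ) :
    (trailDart σ q (i + 1)).1 = (trailDart σ q i).2 := by
  rw [trailDart_succ, dartPerm_apply]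

/-- The graph formed by the edges of the first `m` darts of the trail that starts with `q`. -/
def trail (q : Fin n × Fin n) (m : ℕ) : SimpleGraph (Fin n) where
  Adj a b := a ≠ b ∧ ∃ i < m, trailDart σ q i = (a, b) ∨ trailDart σ q i = (b, a)
  symm := ⟨fun a b h => ⟨h.1.symm, by
    obtain ⟨_, i, hi, h⟩ := h
    exact ⟨i, hi, h.symm⟩⟩⟩
  loopless := ⟨fun a h => h.1 rfl⟩

/-- The graph formed by the edges of `D` on the circuits of the first `j` darts. -/
def firstCircuits (D : SimpleGraph (Fin n)) (j : ℕ) : SimpleGraph (Fin n) where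
  Adj a b := D.Adj a b ∧ ∃ p, (finProdFinEquiv p : ℕ) < j ∧
    ((dartPerm σ).SameCycle p (a, b) ∨ (dartPerm σ).SameCycle p (b, a))
  symm := ⟨fun a b h => ⟨h.1.symm, by
    obtain ⟨_, p, hp, h⟩ := h
    exact ⟨p, hp, h.symm⟩⟩⟩
  loopless := ⟨fun a h => h.1.ne rfl⟩

/-- The edge set `K` is a union of circuits. -/
def IsCircuitClosed (D K : SimpleGraph (Fin n)) : Prop :=
  K ≤ D ∧ ∀ a b, K.Adj a b → K.Adj b (σ b a)

lemma trail_zero (q : Fin n × Fin n) : trail σ q 0 = ⊥ := by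
  ext a b
  simp [trail]

lemma trail_succ (q : Fin n × Fin n) (m : ℕ) :
    trail σ q (m + 1) = trail σ q m ⊔ edge (trailDart σ q m).1 (trailDart σ q m).2 := by
  ext a b
  simp only [trail, sup_adj, edge_adj, Prod.ext_iff]
  constructor
  · rintro ⟨hab, i, hi, h⟩
    rcases Nat.lt_succ_iff_lt_or_eq.1 hi with h1 | rfl
    · exact Or.inl ⟨hab, i, h1, h⟩
    · refine Or.inr ⟨?_, hab⟩
      rcases h with ⟨h1, h2⟩ | ⟨h1, h2⟩
      · exact Or.inl ⟨h1.symm, h2.symm⟩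
      · exact Or.inr ⟨h2.symm, h1.symm⟩
  · rintro (⟨hab, i, hi, h⟩ | ⟨h, hab⟩)
    · exact ⟨hab, i, by omega, h⟩
    · refine ⟨hab, m, by omega, ?_⟩
      rcases h with ⟨h1, h2⟩ | ⟨h1, h2⟩
      · exact Or.inl ⟨h1.symm, h2.symm⟩
      · exact Or.inr ⟨h2.symm, h1.symm⟩

lemma trail_adj {q : Fin n × Fin n} {m : ℕ} {a b : Fin n} :
    (trail σ q m).Adj a b ↔
      a ≠ b ∧ ∃ i < m, trailDart σ q i = (a, b) ∨ trailDart σ q i = (b, a) := Iff.rfl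

/-- The length of the circuit of `q`. -/
def circuitLength (q : Fin n × Fin n) : ℕ := Function.minimalPeriod (dartPerm σ) q

lemma trailDart_eq_iterate (q : Fin n × Fin n) (i : ℕ) :
    trailDart σ q i = (dartPerm σ)^[i] q := by
  rw [Equiv.Perm.iterate_eq_pow]; rfl

lemma circuitLength_pos (q : Fin n × Fin n) : 0 < circuitLength σ q :=
  Function.minimalPeriod_pos_of_mem_periodicPts
    ((dartPerm σ).injective.mem_periodicPts q)

lemma trailDart_circuitLength (q : Fin n × Fin n) : trailDart σ q (circuitLength σ q) = q := by
  rw [trailDart_eq_iterate]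
  exact Function.iterate_minimalPeriod

lemma trailDart_inj {q : Fin n × Fin n} {i j : ℕ} (hi : i < circuitLength σ q)
    (hj : j < circuitLength σ q) (h : trailDart σ q i = trailDart σ q j) : i = j := by
  rw [trailDart_eq_iterate, trailDart_eq_iterate] at h
  exact Function.iterate_injOn_Iio_minimalPeriod hi hj h

lemma circuitLength_le (q : Fin n × Fin n) : circuitLength σ q ≤ n * n := by
  have := Fintype.card_le_of_injective
    (fun i : Fin (circuitLength σ q) => trailDart σ q i)
    (fun i j h => Fin.ext (trailDart_inj σ i.2 j.2 h))
  simpa using this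

lemma sameCycle_trailDart (q : Fin n × Fin n) (i : ℕ) :
    (dartPerm σ).SameCycle q (trailDart σ q i) :=
  Equiv.Perm.sameCycle_pow_right.2 (Equiv.Perm.SameCycle.refl _ _)

lemma exists_trailDart_of_sameCycle {q p : Fin n × Fin n} (h : (dartPerm σ).SameCycle q p) :
    ∃ i < circuitLength σ q, trailDart σ q i = p := by
  obtain ⟨i, hi⟩ := h.exists_nat_pow_eq
  refine ⟨i % circuitLength σ q, Nat.mod_lt _ (circuitLength_pos σ q), ?_⟩
  rw [trailDart_eq_iterate, circuitLength, Function.iterate_mod_minimalPeriod_eq,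
    ← trailDart_eq_iterate]
  exact hi

lemma trail_circuitLength_adj {q : Fin n × Fin n} {a b : Fin n} :
    (trail σ q (circuitLength σ q)).Adj a b ↔
      a ≠ b ∧ ((dartPerm σ).SameCycle q (a, b) ∨ (dartPerm σ).SameCycle q (b, a)) := by
  rw [trail_adj]
  refine and_congr_right fun _ => ⟨?_, ?_⟩
  · rintro ⟨i, _, h | h⟩
    · exact Or.inl (h ▸ sameCycle_trailDart σ q i)
    · exact Or.inr (h ▸ sameCycle_trailDart σ q i)
  · rintro (h | h)
    · obtain ⟨i, hi, h⟩ := exists_trailDart_of_sameCycle σ h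
      exact ⟨i, hi, Or.inl h⟩
    · obtain ⟨i, hi, h⟩ := exists_trailDart_of_sameCycle σ h
      exact ⟨i, hi, Or.inr h⟩

end Circuits

section Alternating

variable {σ : Fin n → Equiv.Perm (Fin n)} {D G H K : SimpleGraph (Fin n)}

/-- Since each `σ b` is an involution, reversing darts conjugates the successor permutation to its
inverse. -/
lemma dartPerm_swap (hσ : σ ∈ pairings D G.Adj) (p : Fin n × Fin n) :
    dartPerm σ (dartPerm σ p).swap = p.swap := by
  simp only [dartPerm_apply, Prod.swap]
  rw [(mem_pairings.1 hσ p.2).1]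

lemma dartPerm_pow_swap (hσ : σ ∈ pairings D G.Adj) (p : Fin n × Fin n) (m : ℕ) :
    (dartPerm σ ^ m) ((dartPerm σ ^ m) p).swap = p.swap := by
  induction m with
  | zero => rfl
  | succ m ih =>
    rw [show (dartPerm σ ^ (m + 1)) p = dartPerm σ ((dartPerm σ ^ m) p) by
      rw [pow_succ', Equiv.Perm.mul_apply], pow_succ, Equiv.Perm.mul_apply, dartPerm_swap hσ, ih]

lemma trailDart_adj_and_colour (hσ : σ ∈ pairings D G.Adj) {q : Fin n × Fin n}
    (hq : D.Adj q.1 q.2) (i : ℕ) :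
    D.Adj (trailDart σ q i).1 (trailDart σ q i).2 ∧
      (G.Adj (trailDart σ q i).1 (trailDart σ q i).2 ↔ (G.Adj q.1 q.2 ↔ Even i)) := by
  induction i with
  | zero => simpa [trailDart_zero] using hq
  | succ i ih =>
    have h := ((mem_pairings.1 hσ (trailDart σ q i).2).2 (trailDart σ q i).1).2 ih.1.symm
    rw [trailDart_succ, dartPerm_apply]
    refine ⟨h.1, ?_⟩
    rw [h.2, G.adj_comm, ih.2, Nat.even_add_one]
    tauto

/-- No circuit runs through an edge in both directions. If dart m were the reverse of dart 0,
alternation would make m = 2t even; the reversal symmetry would then make dart t its own reverse,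
hence a loop. -/
lemma trailDart_ne_swap_self (hσ : σ ∈ pairings D G.Adj) {q : Fin n × Fin n}
    (hq : D.Adj q.1 q.2) (m : ℕ) : trailDart σ q m ≠ q.swap := by
  intro h
  have h1 := (trailDart_adj_and_colour hσ hq m).2
  have hm : Even m := by
    rw [h] at h1
    simp only [Prod.fst_swap, Prod.snd_swap] at h1
    rw [G.adj_comm] at h1
    tauto
  obtain ⟨t, rfl⟩ := hm
  have h2 := dartPerm_pow_swap hσ q t
  unfold trailDart at h
  rw [pow_add, Equiv.Perm.mul_apply, ← h2] at h
  have h3 := (dartPerm σ ^ t).injective h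
  have h4 := (trailDart_adj_and_colour hσ hq t).1
  unfold trailDart at h4
  exact h4.ne (congrArg Prod.fst h3)

lemma trailDart_ne_swap (hσ : σ ∈ pairings D G.Adj) {q : Fin n × Fin n}
    (hq : D.Adj q.1 q.2) (i k : ℕ) : trailDart σ q i ≠ (trailDart σ q k).swap := by
  have key : ∀ i k, k ≤ i → trailDart σ q i ≠ (trailDart σ q k).swap := by
    intro i k hik
    obtain ⟨t, rfl⟩ := Nat.exists_eq_add_of_le hik
    have h := trailDart_ne_swap_self hσ (trailDart_adj_and_colour hσ hq k).1 t
    have e : trailDart σ (trailDart σ q k) t = trailDart σ q (k + t) := by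
      unfold trailDart
      rw [← Equiv.Perm.mul_apply, ← pow_add, add_comm]
    rwa [e] at h
  rcases le_total k i with h | h
  · exact key i k h
  · intro h'
    exact key k i h (by rw [h', Prod.swap_swap])

lemma even_circuitLength (hσ : σ ∈ pairings D G.Adj) {q : Fin n × Fin n}
    (hq : D.Adj q.1 q.2) : Even (circuitLength σ q) := by
  have h1 := (trailDart_adj_and_colour hσ hq (circuitLength σ q)).2
  rw [trailDart_circuitLength] at h1
  tauto

lemma not_trail_adj (hσ : σ ∈ pairings D G.Adj) {q : Fin n × Fin n} (hq : D.Adj q.1 q.2)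
    {m : ℕ} (hm : m < circuitLength σ q) :
    ¬ (trail σ q m).Adj (trailDart σ q m).1 (trailDart σ q m).2 := by
  rintro ⟨_, i, hi, h | h⟩
  · have := trailDart_inj σ (hi.trans hm) hm h
    omega
  · exact trailDart_ne_swap hσ hq i m h

lemma IsCircuitClosed.adj_iff (hσ : σ ∈ pairings D G.Adj) (hK : IsCircuitClosed σ D K)
    {a b : Fin n} : K.Adj b (σ b a) ↔ K.Adj b a := by
  constructor
  · intro h
    have := hK.2 (σ b a) b h.symm
    rwa [(mem_pairings.1 hσ b).1] at this
  · intro h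
    exact hK.2 a b h.symm

lemma IsCircuitClosed.not_adj_trailDart (hσ : σ ∈ pairings D G.Adj)
    (hK : IsCircuitClosed σ D K) {q : Fin n × Fin n} (hq : ¬ K.Adj q.1 q.2) (i : ℕ) :
    ¬ K.Adj (trailDart σ q i).1 (trailDart σ q i).2 := by
  induction i with
  | zero => exact hq
  | succ i ih =>
    rw [trailDart_succ, dartPerm_apply, hK.adj_iff hσ, K.adj_comm]
    exact ih

/-- A circuit occurs as two dart cycles, one for each orientation. The step from ab to its partner
at b follows the permutation in one orientation and its inverse in the other. -/
lemma isCircuitClosed_firstCircuits (hσ : σ ∈ pairings D G.Adj) (j : ℕ) :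
    IsCircuitClosed σ D (firstCircuits σ D j) := by
  refine ⟨fun a b h => h.1, ?_⟩
  rintro a b ⟨hab, p, hp, h⟩
  refine ⟨(((mem_pairings.1 hσ b).2 a).2 hab.symm).1, p, hp, ?_⟩
  rcases h with h | h
  · left
    exact Equiv.Perm.sameCycle_apply_right.2 h
  · right
    have e : dartPerm σ (σ b a, b) = (b, a) := by
      rw [dartPerm_apply]
      simp [(mem_pairings.1 hσ b).1]
    rw [← e] at h
    exact Equiv.Perm.sameCycle_apply_right.1 h

lemma firstCircuits_zero (σ : Fin n → Equiv.Perm (Fin n)) (D : SimpleGraph (Fin n)) :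
    firstCircuits σ D 0 = ⊥ := by
  ext a b
  simp [firstCircuits]

lemma firstCircuits_last (σ : Fin n → Equiv.Perm (Fin n)) (D : SimpleGraph (Fin n)) :
    firstCircuits σ D (n * n) = D := by
  ext a b
  refine ⟨fun h => h.1, fun h => ⟨h, (a, b), (finProdFinEquiv (a, b)).2, Or.inl ?_⟩⟩
  exact Equiv.Perm.SameCycle.refl _ _

lemma dart_eq_of_index (p p' : Fin n × Fin n)
    (h : (finProdFinEquiv p : ℕ) = (finProdFinEquiv p' : ℕ)) : p = p' :=
  finProdFinEquiv.injective (Fin.ext h)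

/-- If the `j`-th dart `p` already lies on an earlier circuit or outside `D`, nothing is added. -/
lemma firstCircuits_succ_of_adj (hσ : σ ∈ pairings D G.Adj) {p : Fin n × Fin n}
    (h : D.Adj p.1 p.2 → (firstCircuits σ D (finProdFinEquiv p : ℕ)).Adj p.1 p.2) :
    firstCircuits σ D ((finProdFinEquiv p : ℕ) + 1) = firstCircuits σ D (finProdFinEquiv p : ℕ) := by
  have hc := isCircuitClosed_firstCircuits hσ (finProdFinEquiv p : ℕ)
  have key : ∀ a b, D.Adj a b → (dartPerm σ).SameCycle p (a, b) →
      (firstCircuits σ D (finProdFinEquiv p : ℕ)).Adj a b := by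
    intro a b hab hs
    by_cases hp : D.Adj p.1 p.2
    · obtain ⟨i, _, hi⟩ := exists_trailDart_of_sameCycle σ hs.symm
      by_contra hcon
      have := hc.not_adj_trailDart hσ (q := (a, b)) hcon i
      rw [hi] at this
      exact this (h hp)
    · obtain ⟨i, _, hi⟩ := exists_trailDart_of_sameCycle σ hs.symm
      have := (trailDart_adj_and_colour hσ (q := (a, b)) hab i).1
      rw [hi] at this
      exact absurd this hp
  ext a b
  constructor
  · rintro ⟨hab, p', hp', h'⟩
    rcases Nat.lt_succ_iff_lt_or_eq.1 hp' with h1 | h1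
    · exact ⟨hab, p', h1, h'⟩
    · obtain rfl := dart_eq_of_index _ _ h1
      rcases h' with h' | h'
      · exact key a b hab h'
      · exact (key b a hab.symm h').symm
  · rintro ⟨hab, p', hp', h'⟩
    exact ⟨hab, p', by omega, h'⟩

lemma firstCircuits_succ_eq_trail (hσ : σ ∈ pairings D G.Adj) {p q : Fin n × Fin n}
    (hp : D.Adj p.1 p.2) (hpq : (dartPerm σ).SameCycle p q) :
    firstCircuits σ D ((finProdFinEquiv p : ℕ) + 1)
      = firstCircuits σ D (finProdFinEquiv p : ℕ) ⊔ trail σ q (circuitLength σ q) := by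
  have hD : ∀ a b, (dartPerm σ).SameCycle q (a, b) → D.Adj a b := by
    intro a b hs
    obtain ⟨i, _, hi⟩ := exists_trailDart_of_sameCycle σ (hpq.trans hs)
    have := (trailDart_adj_and_colour hσ hp i).1
    rwa [hi] at this
  ext a b
  rw [sup_adj, trail_circuitLength_adj]
  constructor
  · rintro ⟨hab, p', hp', h'⟩
    rcases Nat.lt_succ_iff_lt_or_eq.1 hp' with h1 | h1
    · exact Or.inl ⟨hab, p', h1, h'⟩
    · obtain rfl := dart_eq_of_index _ _ h1
      exact Or.inr ⟨hab.ne, h'.imp hpq.symm.trans hpq.symm.trans⟩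
  · rintro (⟨hab, p', hp', h'⟩ | ⟨hab, h'⟩)
    · exact ⟨hab, p', by omega, h'⟩
    · refine ⟨?_, p, Nat.lt_succ_self _, h'.imp hpq.trans hpq.trans⟩
      rcases h' with h' | h'
      · exact hD a b h'
      · exact (hD b a h').symm

end Alternating

/-! ### Encodings of intermediate states -/

/-- The colouring of half-edges by `Z`, changed at the half-edges `f₁` and `f₂`. -/
def flipColour (Z : SimpleGraph (Fin n)) (f₁ f₂ : Fin n × Fin n) (b a : Fin n) : Prop :=
  Z.Adj b a ↔ ¬ ((b, a) = f₁ ∨ (b, a) = f₂)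

/-- The complement of `Z` in `D` is a state up to at most two additional edges, and the pairing `σ`
respects the colouring by `Z` up to at most two half-edges. -/
def HasEncoding (d : Fin n → ℕ) (D : SimpleGraph (Fin n)) (σ : Fin n → Equiv.Perm (Fin n))
    (Z : SimpleGraph (Fin n)) : Prop :=
  ∃ f₁ f₂ g₁ g₂ : Fin n × Fin n, ∃ L : JSState d,
    L.1 ⊔ edge g₁.1 g₁.2 ⊔ edge g₂.1 g₂.2 = D ∆ Z ∧ σ ∈ pairings D (flipColour Z f₁ f₂)

/-- At each pair of nodes, switching only decides which of two complementary graphs receives an edge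
of `G ∆ H`; edges common to `G` and `H` belong to both. -/
lemma intDegree_symmDiff_add {G H K : SimpleGraph (Fin n)} (hK : K ≤ G ∆ H) (v : Fin n) :
    intDegree (G ∆ K) v + intDegree ((G ∆ H) ∆ (G ∆ K)) v = intDegree G v + intDegree H v := by
  unfold intDegree
  rw [← Finset.sum_add_distrib, ← Finset.sum_add_distrib]
  refine Finset.sum_congr rfl fun a _ => ?_
  have h : K.Adj v a → (G.Adj v a ↔ ¬ H.Adj v a) := fun h => symmDiff_adj.1 (hK h)
  simp only [symmDiff_adj]
  by_cases h1 : G.Adj v a <;> by_cases h2 : H.Adj v a <;> by_cases h3 : K.Adj v a <;>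
    simp [h1, h2, h3] at h ⊢

/-- Recolouring a set of half-edges that contains each half-edge together with its partner keeps
partners differently coloured. -/
lemma mem_pairings_of_closed {σ : Fin n → Equiv.Perm (Fin n)} {D G : SimpleGraph (Fin n)}
    (hσ : σ ∈ pairings D G.Adj) {c S : Fin n → Fin n → Prop}
    (hS : ∀ b a, D.Adj b a → S b a → S b (σ b a))
    (hc : ∀ b a, D.Adj b a → (c b a ↔ (G.Adj b a ↔ ¬ S b a))) : σ ∈ pairings D c := by
  rw [mem_pairings] at hσ ⊢
  refine fun b => ⟨(hσ b).1, fun a => ⟨((hσ b).2 a).1, fun ha => ?_⟩⟩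
  obtain ⟨h1, h2⟩ := ((hσ b).2 a).2 ha
  have h3 : S b (σ b a) ↔ S b a := by
    refine ⟨fun h => ?_, hS b a ha⟩
    have := hS b _ h1 h
    rwa [(hσ b).1] at this
  refine ⟨h1, ?_⟩
  rw [hc b _ h1, hc b a ha, h2, h3]
  tauto

lemma hasEncoding_of_closed {σ : Fin n → Equiv.Perm (Fin n)} {G H K : SimpleGraph (Fin n)}
    (hn : 0 < n) (hG : IsRealization d G) (hH : IsRealization d H)
    (hσ : σ ∈ pairings (G ∆ H) G.Adj) (hK : IsCircuitClosed σ (G ∆ H) K)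
    (hZ : IsRealization d (G ∆ K)) : HasEncoding d (G ∆ H) σ (G ∆ K) := by
  have hL : IsRealization d ((G ∆ H) ∆ (G ∆ K)) := by
    rw [isRealization_iff] at *
    intro v
    have := intDegree_symmDiff_add hK.1 v
    rw [hG, hH, hZ] at this
    linarith
  -- A loop serves as a dummy: it adds no edge and is not a half-edge of `G ∆ H`.
  let o : Fin n × Fin n := (⟨0, hn⟩, ⟨0, hn⟩)
  refine ⟨o, o, o, o, ⟨_, hL.isNearRealization⟩, by simp [o], ?_⟩
  refine mem_pairings_of_closed hσ (S := fun b a => K.Adj b a)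
    (fun b a _ h => hK.2 a b h.symm) fun b a hab => ?_
  have : ¬ ((b, a) = o ∨ (b, a) = o) := by
    rintro (h | h) <;>
    · rw [Prod.ext_iff] at h
      exact hab.ne (h.1.trans h.2.symm)
  simp only [flipColour, this, not_false_eq_true, iff_true, symmDiff_adj]

/-! ### Processing a circuit -/

section Stage

variable {σ : Fin n → Equiv.Perm (Fin n)} {G H K : SimpleGraph (Fin n)} {q : Fin n × Fin n}

/-- The graph obtained from `G` after switching `K` and the first `m` edges of the trail of `q`. -/
def switched (σ : Fin n → Equiv.Perm (Fin n)) (G K : SimpleGraph (Fin n)) (q : Fin n × Fin n)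
    (m : ℕ) : SimpleGraph (Fin n) := G ∆ (K ⊔ trail σ q m)

lemma switched_zero (σ : Fin n → Equiv.Perm (Fin n)) (G K : SimpleGraph (Fin n))
    (q : Fin n × Fin n) : switched σ G K q 0 = G ∆ K := by
  unfold switched
  rw [trail_zero, sup_bot_eq]

/-- `K` is a union of circuits of `σ`, switching it yields a realization, and `q` is a dart of `G`
on a circuit outside `K`. -/
structure IsStage (d : Fin n → ℕ) (σ : Fin n → Equiv.Perm (Fin n)) (G H K : SimpleGraph (Fin n))
    (q : Fin n × Fin n) : Prop where
  left : IsRealization d G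
  right : IsRealization d H
  pairing : σ ∈ pairings (G ∆ H) G.Adj
  closed : IsCircuitClosed σ (G ∆ H) K
  start : IsRealization d (G ∆ K)
  dart : (G ∆ H).Adj q.1 q.2
  dart_left : G.Adj q.1 q.2
  dart_not : ¬ K.Adj q.1 q.2

namespace IsStage

variable (h : IsStage d σ G H K q)
include h

lemma adj (m : ℕ) : (G ∆ H).Adj (trailDart σ q m).1 (trailDart σ q m).2 :=
  (trailDart_adj_and_colour h.pairing h.dart m).1

lemma left_adj (m : ℕ) : G.Adj (trailDart σ q m).1 (trailDart σ q m).2 ↔ Even m := by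
  rw [(trailDart_adj_and_colour h.pairing h.dart m).2]
  simp [h.dart_left]

lemma not_adj (m : ℕ) : ¬ K.Adj (trailDart σ q m).1 (trailDart σ q m).2 :=
  h.closed.not_adj_trailDart h.pairing h.dart_not m

lemma not_sup_adj {m : ℕ} (hm : m < circuitLength σ q) :
    ¬ (K ⊔ trail σ q m).Adj (trailDart σ q m).1 (trailDart σ q m).2 := by
  rw [sup_adj]
  rintro (h' | h')
  · exact h.not_adj m h'
  · exact not_trail_adj h.pairing h.dart hm h'

lemma switched_adj {m : ℕ} (hm : m < circuitLength σ q) :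
    (switched σ G K q m).Adj (trailDart σ q m).1 (trailDart σ q m).2 ↔ Even m := by
  unfold switched
  rw [symmDiff_adj, h.left_adj]
  simp only [h.not_sup_adj hm, not_false_eq_true, iff_true]

lemma switched_succ {m : ℕ} (hm : m < circuitLength σ q) :
    switched σ G K q (m + 1)
      = switched σ G K q m ∆ edge (trailDart σ q m).1 (trailDart σ q m).2 := by
  unfold switched
  rw [trail_succ, ← sup_assoc,
    ← ((SimpleGraph.disjoint_edge _).2 (h.not_sup_adj hm)).symmDiff_eq_sup, symmDiff_assoc]

lemma switched_succ_even {m : ℕ} (hm : m < circuitLength σ q) (he : Even m) :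
    switched σ G K q (m + 1)
      = switched σ G K q m \ edge (trailDart σ q m).1 (trailDart σ q m).2 := by
  rw [h.switched_succ hm,
    symmDiff_of_ge ((edge_le_iff _).2 (Or.inr ((h.switched_adj hm).2 he)))]

lemma switched_succ_odd {m : ℕ} (hm : m < circuitLength σ q) (he : ¬ Even m) :
    switched σ G K q (m + 1)
      = switched σ G K q m ⊔ edge (trailDart σ q m).1 (trailDart σ q m).2 := by
  rw [h.switched_succ hm, ((SimpleGraph.disjoint_edge _).2
    (fun h' => he ((h.switched_adj hm).1 h'))).symmDiff_eq_sup]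

/-- Deletions and insertions alternate along the trail, so they cancel at each interior visit of a
node and only the two ends contribute. -/
lemma intDegree_switched {m : ℕ} (hm : m < circuitLength σ q) (v : Fin n) :
    intDegree (switched σ G K q (m + 1)) v
      = d v - (if v = q.1 then 1 else 0)
        + (if Even m then -1 else 1) * (if v = (trailDart σ q m).2 then 1 else 0) := by
  induction m with
  | zero =>
    rw [h.switched_succ_even hm (by simp),
      intDegree_sdiff_edge ((h.switched_adj hm).2 (by simp)), switched_zero,
      isRealization_iff.1 h.start, trailDart_zero]
    simp only [Even.zero, if_true]
    ring
  | succ m ih =>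
    specialize ih (by omega)
    by_cases he : Even m
    · have he' : ¬ Even (m + 1) := by rw [Nat.even_add_one]; tauto
      rw [h.switched_succ_odd hm he',
        intDegree_sup_edge (h.adj _).ne (fun h' => he' ((h.switched_adj hm).1 h')), ih,
        trailDart_succ_fst]
      simp only [he, he', if_true, if_false]
      ring
    · have he' : Even (m + 1) := by rw [Nat.even_add_one]; exact he
      rw [h.switched_succ_even hm he',
        intDegree_sdiff_edge ((h.switched_adj hm).2 he'), ih, trailDart_succ_fst]
      simp only [he, he', if_true, if_false]
      ring

/-- At each interior visit of the trail both partners are switched, so alternation survives. The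
possible exceptions are the half-edge that leaves the start and the one that enters the current end;
flipping their colours back repairs the pairing there. -/
lemma pairing_switched {m : ℕ} (hm : m < circuitLength σ q) :
    σ ∈ pairings (G ∆ H)
      (flipColour (switched σ G K q (m + 1)) q (trailDart σ q m).swap) := by
  refine mem_pairings_of_closed h.pairing
    -- The switched half-edges without the two ends: those of `K`, the arrivals of the darts before
    -- dart m, and the departures of the darts after dart 0.
    (S := fun b a => K.Adj b a ∨ (∃ i < m, trailDart σ q i = (a, b)) ∨
      ∃ i, 1 ≤ i ∧ i ≤ m ∧ trailDart σ q i = (b, a)) ?_ ?_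
  · rintro b a hab (h1 | ⟨i, hi, h1⟩ | ⟨i, hi, hi', h1⟩)
    · exact Or.inl (h.closed.2 a b h1.symm)
    · refine Or.inr (Or.inr ⟨i + 1, by omega, by omega, ?_⟩)
      rw [trailDart_succ, h1, dartPerm_apply]
    · refine Or.inr (Or.inl ⟨i - 1, by omega, ?_⟩)
      obtain ⟨i, rfl⟩ := Nat.exists_eq_add_of_le' hi
      rw [trailDart_succ] at h1
      rw [Nat.add_sub_cancel]
      apply (dartPerm σ).injective
      rw [h1, dartPerm_apply]
      simp [(mem_pairings.1 h.pairing b).1]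
  · intro b a hab
    have hsw : ∀ i k, trailDart σ q i ≠ (trailDart σ q k).swap :=
      trailDart_ne_swap h.pairing h.dart
    have hq0 : trailDart σ q 0 = q := trailDart_zero σ q
    unfold flipColour switched
    rw [symmDiff_adj, sup_adj, trail_adj]
    by_cases e1 : (b, a) = q
    · have hK : ¬ K.Adj b a := by
        have := h.dart_not
        rw [← e1] at this
        exact this
      have hT : ∃ i < m + 1, trailDart σ q i = (b, a) ∨ trailDart σ q i = (a, b) :=
        ⟨0, by omega, Or.inl (hq0.trans e1.symm)⟩
      have hS1 : ¬ ∃ i < m, trailDart σ q i = (a, b) := by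
        rintro ⟨i, _, hi⟩
        apply hsw i 0
        rw [hi, hq0, ← e1]; rfl
      have hS2 : ¬ ∃ i, 1 ≤ i ∧ i ≤ m ∧ trailDart σ q i = (b, a) := by
        rintro ⟨i, hi1, hi2, hi⟩
        have := trailDart_inj σ (q := q) (i := i) (j := 0) (by omega) (by omega)
          (by rw [hi, hq0, e1])
        omega
      have hT' := show K.Adj b a ∨ b ≠ a ∧ _ from Or.inr ⟨hab.ne, hT⟩
      have hS' : ¬ (K.Adj b a ∨ (∃ i < m, trailDart σ q i = (a, b)) ∨
          ∃ i, 1 ≤ i ∧ i ≤ m ∧ trailDart σ q i = (b, a)) := by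
        rintro (h' | h' | h')
        exacts [hK h', hS1 h', hS2 h']
      have hf : (b, a) = q ∨ (b, a) = (trailDart σ q m).swap := Or.inl e1
      simp only [hT', hS', hf, not_true_eq_false, not_false_eq_true, iff_false, iff_true, not_not]
    · by_cases e2 : (b, a) = (trailDart σ q m).swap
      · have e2' : trailDart σ q m = (a, b) := by
          rw [← Prod.swap_swap (trailDart σ q m), ← e2]; rfl
        have hK : ¬ K.Adj b a := by
          have := h.not_adj m
          rw [e2'] at this
          rwa [K.adj_comm]
        have hT : ∃ i < m + 1, trailDart σ q i = (b, a) ∨ trailDart σ q i = (a, b) :=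
          ⟨m, by omega, Or.inr e2'⟩
        have hS1 : ¬ ∃ i < m, trailDart σ q i = (a, b) := by
          rintro ⟨i, hi', hi⟩
          have := trailDart_inj σ (q := q) (i := i) (j := m) (by omega) (by omega)
            (by rw [hi, e2'])
          omega
        have hS2 : ¬ ∃ i, 1 ≤ i ∧ i ≤ m ∧ trailDart σ q i = (b, a) := by
          rintro ⟨i, hi1, hi2, hi⟩
          exact hsw i m (by rw [hi, e2])
        have hT' := show K.Adj b a ∨ b ≠ a ∧ _ from Or.inr ⟨hab.ne, hT⟩
        have hS' : ¬ (K.Adj b a ∨ (∃ i < m, trailDart σ q i = (a, b)) ∨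
            ∃ i, 1 ≤ i ∧ i ≤ m ∧ trailDart σ q i = (b, a)) := by
          rintro (h' | h' | h')
          exacts [hK h', hS1 h', hS2 h']
        have hf : (b, a) = q ∨ (b, a) = (trailDart σ q m).swap := Or.inr e2
        simp only [hT', hS', hf, not_true_eq_false, not_false_eq_true, iff_false, iff_true, not_not]
      · have key : (b ≠ a ∧ ∃ i < m + 1, trailDart σ q i = (b, a) ∨ trailDart σ q i = (a, b)) ↔
            ((∃ i < m, trailDart σ q i = (a, b)) ∨
              ∃ i, 1 ≤ i ∧ i ≤ m ∧ trailDart σ q i = (b, a)) := by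
          constructor
          · rintro ⟨_, i, hi, h1 | h1⟩
            · refine Or.inr ⟨i, ?_, by omega, h1⟩
              rcases Nat.eq_zero_or_pos i with rfl | hi0
              · exact absurd (h1.symm.trans hq0) e1
              · exact hi0
            · refine Or.inl ⟨i, ?_, h1⟩
              rcases Nat.lt_succ_iff_lt_or_eq.1 hi with h2 | rfl
              · exact h2
              · exact absurd (by rw [h1]; rfl) e2
          · rintro (⟨i, hi, h1⟩ | ⟨i, hi, hi', h1⟩)
            · exact ⟨hab.ne, i, by omega, Or.inr h1⟩
            · exact ⟨hab.ne, i, by omega, Or.inl h1⟩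
        rw [key]
        simp only [e1, e2, or_self, not_false_eq_true, iff_true]

end IsStage

end Stage

/-- A move of the JS chain between two states that satisfy `Q`. -/
def StepWithin (Q : JSState d → Prop) (x y : JSState d) : Prop := IsArc (jsP d) x y ∧ Q x ∧ Q y

lemma trailDart_last {σ : Fin n → Equiv.Perm (Fin n)} {q : Fin n × Fin n} {m : ℕ}
    (hm : m + 1 = circuitLength σ q) : (trailDart σ q m).2 = q.1 := by
  rw [← trailDart_succ_fst, hm, trailDart_circuitLength]

section Stage

variable {σ : Fin n → Equiv.Perm (Fin n)} {G H K : SimpleGraph (Fin n)} {q : Fin n × Fin n}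

namespace IsStage

variable (h : IsStage d σ G H K q)
include h

lemma sup_trail_le (m : ℕ) : K ⊔ trail σ q m ≤ G ∆ H := by
  refine sup_le h.closed.1 ?_
  rintro a b ⟨_, i, _, hi | hi⟩
  · have := h.adj i
    rwa [hi] at this
  · have := h.adj i
    rw [hi] at this
    exact this.symm

lemma intDegree_compl_switched (m : ℕ) (v : Fin n) :
    intDegree ((G ∆ H) ∆ switched σ G K q m) v = 2 * d v - intDegree (switched σ G K q m) v := by
  have := intDegree_symmDiff_add (h.sup_trail_le m) v
  rw [isRealization_iff.1 h.left, isRealization_iff.1 h.right] at this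
  unfold switched
  linarith

lemma compl_switched_adj {m i : ℕ} (hi : i < m) (he : Even i) :
    ((G ∆ H) ∆ switched σ G K q m).Adj (trailDart σ q i).1 (trailDart σ q i).2 := by
  have h1 : (K ⊔ trail σ q m).Adj (trailDart σ q i).1 (trailDart σ q i).2 :=
    Or.inr ⟨(h.adj i).ne, i, hi, Or.inl rfl⟩
  have h2 := (h.left_adj i).2 he
  unfold switched
  rw [symmDiff_adj, symmDiff_adj (G := G) (H := K ⊔ trail σ q m)]
  simp only [h.adj i, h1, h2, not_true_eq_false, iff_false, not_false_eq_true]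

lemma isNearRealization_switched {m : ℕ} (hm : m < circuitLength σ q) (he : Even m) :
    IsNearRealization d (switched σ G K q (m + 1)) := by
  refine isNearRealization_of_deficit q.1 (trailDart σ q m).2 fun v => ?_
  rw [h.intDegree_switched hm, if_pos he]
  ring

lemma isRealization_switched {m : ℕ} (hm : m < circuitLength σ q) (he : ¬ Even m)
    (hq : (trailDart σ q m).2 = q.1) : IsRealization d (switched σ G K q (m + 1)) := by
  rw [isRealization_iff]
  intro v
  rw [h.intDegree_switched hm, if_neg he, hq]
  ring

/-- The complement has one excess degree at each end of the trail. It contains the deleted G-edges,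
in particular the first and the last edge of the trail; removing these moves the excess to a deficit
at their other end nodes. -/
lemma hasEncoding_even {m : ℕ} (hm : m < circuitLength σ q) (he : Even m) :
    HasEncoding d (G ∆ H) σ (switched σ G K q (m + 1)) := by
  set L := (G ∆ H) ∆ switched σ G K q (m + 1) with hL
  have hdeg : ∀ v, intDegree L v
      = d v + (if v = q.1 then 1 else 0) + (if v = (trailDart σ q m).2 then 1 else 0) := by
    intro v
    rw [hL, h.intDegree_compl_switched, h.intDegree_switched hm, if_pos he]
    ring
  have h0 : L.Adj q.1 q.2 := h.compl_switched_adj (i := 0) (by omega) (by simp)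
  have h1 : L.Adj (trailDart σ q m).1 (trailDart σ q m).2 :=
    h.compl_switched_adj (by omega) he
  rcases Nat.eq_zero_or_pos m with rfl | hm0
  -- For m = 0 the first and last edges coincide, and removing this single edge already cancels both
  -- excesses.
  · have hr : IsRealization d (L \ edge q.1 q.2) := by
      rw [isRealization_iff]
      intro v
      rw [intDegree_sdiff_edge h0, hdeg, trailDart_zero]
      ring
    refine ⟨q, (trailDart σ q 0).swap, q, q, ⟨_, hr.isNearRealization⟩, ?_,
      h.pairing_switched hm⟩
    rw [sup_assoc, sup_idem, sdiff_sup_edge h0]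
  · have h2 : (L \ edge q.1 q.2).Adj (trailDart σ q m).1 (trailDart σ q m).2 := by
      rw [sdiff_adj]
      refine ⟨h1, ?_⟩
      rw [edge_adj]
      rintro ⟨h3 | h3, _⟩
      · have := trailDart_inj σ (q := q) (i := m) (j := 0) hm (by omega)
          (Prod.ext h3.1 h3.2)
        omega
      · exact trailDart_ne_swap h.pairing h.dart m 0 (Prod.ext h3.1 h3.2)
    have hr : IsNearRealization d
        ((L \ edge q.1 q.2) \ edge (trailDart σ q m).1 (trailDart σ q m).2) := by
      refine isNearRealization_of_deficit q.2 (trailDart σ q m).1 fun v => ?_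
      rw [intDegree_sdiff_edge h2, intDegree_sdiff_edge h0, hdeg]
      ring
    refine ⟨q, (trailDart σ q m).swap, trailDart σ q m, q, ⟨_, hr⟩, ?_, h.pairing_switched hm⟩
    rw [sdiff_sup_edge h2, sdiff_sup_edge h0]

lemma hasEncoding_odd {m : ℕ} (hm : m < circuitLength σ q) (he : ¬ Even m)
    (hq : (trailDart σ q m).2 = q.1) : HasEncoding d (G ∆ H) σ (switched σ G K q (m + 1)) := by
  have hr : IsRealization d ((G ∆ H) ∆ switched σ G K q (m + 1)) := by
    rw [isRealization_iff]
    intro v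
    rw [h.intDegree_compl_switched, isRealization_iff.1 (h.isRealization_switched hm he hq)]
    ring
  refine ⟨q, (trailDart σ q m).swap, (q.1, q.1), (q.1, q.1), ⟨_, hr.isNearRealization⟩, ?_,
    h.pairing_switched hm⟩
  simp

/-- By induction, two more edges are switched: an insertion at the deficient end node followed by a
deletion. This is one shift move, unless the insertion returns to the deficient start node; then it
completes a realization, where the chain stops, and the deletion is a second move. -/
lemma reach_switched_odd (Q : JSState d → Prop)
    (hQ : ∀ (Z : JSState d) (m : ℕ), m ≤ circuitLength σ q → Z.1 = switched σ G K q m →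
      HasEncoding d (G ∆ H) σ Z.1 → Q Z)
    (Z₀ : JSState d) (hZ₀ : Z₀.1 = G ∆ K) (i : ℕ) (hi : 2 * i < circuitLength σ q)
    (Z : JSState d) (hZ : Z.1 = switched σ G K q (2 * i + 1)) :
    Relation.ReflTransGen (StepWithin Q) Z₀ Z := by
  have hQ0 : Q Z₀ := hQ Z₀ 0 (Nat.zero_le _) (by rw [switched_zero, hZ₀])
    (hZ₀ ▸ hasEncoding_of_closed q.1.pos h.left h.right h.pairing h.closed h.start)
  have hQe : ∀ i, 2 * i < circuitLength σ q → ∀ Z : JSState d,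
      Z.1 = switched σ G K q (2 * i + 1) → Q Z := fun i hi Z hZ =>
    hQ Z _ hi hZ (hZ ▸ h.hasEncoding_even hi (even_two_mul i))
  induction i generalizing Z with
  | zero =>
    refine Relation.ReflTransGen.single ⟨?_, hQ0, hQe 0 hi Z hZ⟩
    refine isArc_delete (hZ₀ ▸ h.start) (i := q.1) (j := q.2) ?_ ?_
    · have := (h.switched_adj hi).2 (even_two_mul 0)
      rw [mul_zero, switched_zero, ← hZ₀] at this
      exact this
    · rw [hZ, h.switched_succ_even hi (even_two_mul 0), mul_zero, switched_zero, ← hZ₀]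
      rfl
  | succ i ih =>
    have hi0 : 2 * i < circuitLength σ q := by omega
    have hi1 : 2 * i + 1 < circuitLength σ q := by omega
    have hi2 : 2 * i + 1 + 1 < circuitLength σ q := by omega
    have ho : ¬ Even (2 * i + 1) := by rw [Nat.even_add_one]; simp
    have he : Even (2 * i + 1 + 1) := by rw [Nat.even_add_one]; exact ho
    have hZ' : Z.1 = switched σ G K q (2 * i + 1 + 1 + 1) := hZ
    let Zp : JSState d := ⟨_, h.isNearRealization_switched hi0 (even_two_mul i)⟩
    have hQp : Q Zp := hQe i hi0 Zp rfl
    have hQZ : Q Z := hQe (i + 1) hi Z hZ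
    refine (ih hi0 Zp rfl).trans ?_
    have hna : ¬ Zp.1.Adj (trailDart σ q (2 * i + 1)).1 (trailDart σ q (2 * i + 1)).2 :=
      fun h' => ho ((h.switched_adj hi1).1 h')
    have hsup : switched σ G K q (2 * i + 1 + 1) = Zp.1 ⊔ edge (trailDart σ q (2 * i + 1)).1
      (trailDart σ q (2 * i + 1)).2 := h.switched_succ_odd hi1 ho
    have hadj := (h.switched_adj hi2).2 he
    have hdel := h.switched_succ_even hi2 he
    by_cases hw : (trailDart σ q (2 * i + 1)).2 = q.1
    · have hr := h.isRealization_switched hi1 ho hw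
      let Zr : JSState d := ⟨_, hr.isNearRealization⟩
      have hQr : Q Zr := hQ Zr _ hi1 rfl (h.hasEncoding_odd hi1 ho hw)
      have harc : IsArc (jsP d) Zp Zr := by
        refine IsArc.symm (isArc_delete hr (i := (trailDart σ q (2 * i + 1)).1)
          (j := (trailDart σ q (2 * i + 1)).2) ?_ ?_)
        · show (switched σ G K q (2 * i + 1 + 1)).Adj _ _
          rw [hsup]
          simp [edge_adj, (h.adj _).ne]
        · show Zp.1 = switched σ G K q (2 * i + 1 + 1) \ _
          rw [hsup, sup_sdiff_edge hna]
      exact (Relation.ReflTransGen.single ⟨harc, hQp, hQr⟩).tail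
        ⟨isArc_delete hr hadj (hZ'.trans hdel), hQr, hQZ⟩
    · refine Relation.ReflTransGen.single ⟨?_, hQp, hQZ⟩
      rw [hsup, trailDart_succ_fst σ q (2 * i + 1)] at hadj
      rw [hsup, trailDart_succ_fst σ q (2 * i + 1)] at hdel
      refine isArc_shift (h.adj _).ne hna ?_ ?_ hadj ?_ (hZ'.trans hdel)
      · rw [h.intDegree_switched hi0, if_pos (even_two_mul i), trailDart_succ_fst]
        split_ifs <;> simp_all
      · have hne : ¬ (trailDart σ q (2 * i + 1)).2 = (trailDart σ q (2 * i)).2 := by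
          rw [← trailDart_succ_fst σ q (2 * i)]
          exact (h.adj _).ne.symm
        rw [h.intDegree_switched hi0, if_neg hw, if_neg hne]
        ring
      · intro h'
        -- If the shift deleted the edge it has just added, the next dart would be the reverse of
        -- the current one.
        refine trailDart_ne_swap h.pairing h.dart (2 * i + 1 + 1) (2 * i + 1) (Prod.ext ?_ h')
        rw [trailDart_succ_fst]; rfl

lemma isRealization_switched_circuit :
    IsRealization d (switched σ G K q (circuitLength σ q)) := by
  obtain ⟨r, hr⟩ := even_circuitLength h.pairing h.dart
  have hpos := circuitLength_pos σ q
  have e : circuitLength σ q - 1 + 1 = circuitLength σ q := by omega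
  rw [← e]
  refine h.isRealization_switched (by omega) ?_ (trailDart_last e)
  rw [Nat.even_iff]
  omega

/-- A circuit has even length, so after all edges but the last are switched, the missing H-edge
joins the current end to the start, and adding it gives a realization. -/
lemma reach_switched_circuit (Q : JSState d → Prop)
    (hQ : ∀ (Z : JSState d) (m : ℕ), m ≤ circuitLength σ q → Z.1 = switched σ G K q m →
      HasEncoding d (G ∆ H) σ Z.1 → Q Z)
    (Z₀ Z₁ : JSState d) (hZ₀ : Z₀.1 = G ∆ K) (hZ₁ : Z₁.1 = switched σ G K q (circuitLength σ q)) :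
    Relation.ReflTransGen (StepWithin Q) Z₀ Z₁ := by
  obtain ⟨r, hr⟩ := even_circuitLength h.pairing h.dart
  have hpos := circuitLength_pos σ q
  obtain ⟨i, rfl⟩ : ∃ i, r = i + 1 := ⟨r - 1, by omega⟩
  have hi : 2 * i < circuitLength σ q := by omega
  have hi1 : 2 * i + 1 < circuitLength σ q := by omega
  have hi2 : 2 * i + 1 + 1 = circuitLength σ q := by omega
  have ho : ¬ Even (2 * i + 1) := by rw [Nat.even_add_one]; simp
  have hlast := trailDart_last hi2
  let Zp : JSState d := ⟨_, h.isNearRealization_switched hi (even_two_mul i)⟩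
  refine (h.reach_switched_odd Q hQ Z₀ hZ₀ i hi Zp rfl).tail ⟨?_, ?_, ?_⟩
  · have hna : ¬ Zp.1.Adj (trailDart σ q (2 * i + 1)).1 (trailDart σ q (2 * i + 1)).2 :=
      fun h' => ho ((h.switched_adj hi1).1 h')
    have hsup : Z₁.1 = Zp.1 ⊔ edge (trailDart σ q (2 * i + 1)).1
      (trailDart σ q (2 * i + 1)).2 := by
      rw [hZ₁, ← hi2]; exact h.switched_succ_odd hi1 ho
    refine IsArc.symm (isArc_delete (hZ₁ ▸ h.isRealization_switched_circuit)
      (i := (trailDart σ q (2 * i + 1)).1) (j := (trailDart σ q (2 * i + 1)).2) ?_ ?_)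
    · rw [hsup]
      simp [edge_adj, (h.adj _).ne]
    · rw [hsup, sup_sdiff_edge hna]
  · exact hQ Zp _ hi1.le rfl (h.hasEncoding_even hi (even_two_mul i))
  · refine hQ Z₁ _ le_rfl hZ₁ ?_
    rw [hZ₁, ← hi2]
    exact h.hasEncoding_odd hi1 ho hlast

end IsStage

end Stage

/-- The states on the canonical route from `G` to `H` that is given by the pairing `σ`. -/
def OnRoute (G H : SimpleGraph (Fin n)) (σ : Fin n → Equiv.Perm (Fin n)) (Z : JSState d) : Prop :=
  ∃ j ≤ n * n, ∃ q, ∃ m ≤ n * n,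
    Z.1 = switched σ G (firstCircuits σ (G ∆ H) j) q m ∧ HasEncoding d (G ∆ H) σ Z.1

/-- The order of the circuits comes from a fixed numbering of the darts, independently of `G`; this
is what lets the switched part be decoded from `G ∆ H`, `σ` and the position alone. -/
lemma reach_firstCircuits {G H : SimpleGraph (Fin n)} {σ : Fin n → Equiv.Perm (Fin n)}
    (hG : IsRealization d G) (hH : IsRealization d H) (hσ : σ ∈ pairings (G ∆ H) G.Adj)
    (j : ℕ) (hj : j ≤ n * n) :
    IsRealization d (G ∆ firstCircuits σ (G ∆ H) j) ∧
    ∀ Z₀ Z : JSState d, Z₀.1 = G → Z.1 = G ∆ firstCircuits σ (G ∆ H) j →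
      Relation.ReflTransGen (StepWithin (OnRoute G H σ)) Z₀ Z := by
  induction j with
  | zero =>
    rw [firstCircuits_zero, symmDiff_bot]
    refine ⟨hG, fun Z₀ Z h0 h1 => ?_⟩
    obtain rfl : Z₀ = Z := Subtype.ext (h0.trans h1.symm)
    exact Relation.ReflTransGen.refl
  | succ j ih =>
    obtain ⟨hr, hreach⟩ := ih (by omega)
    obtain ⟨p, hp⟩ : ∃ p : Fin n × Fin n, (finProdFinEquiv p : ℕ) = j :=
      ⟨finProdFinEquiv.symm ⟨j, hj⟩, by rw [Equiv.apply_symm_apply]⟩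
    -- Darts outside `G ∆ H`, and darts of circuits already switched, require no moves.
    by_cases hin : (G ∆ H).Adj p.1 p.2 → (firstCircuits σ (G ∆ H) j).Adj p.1 p.2
    · subst hp
      rw [firstCircuits_succ_of_adj hσ hin]
      exact ⟨hr, hreach⟩
    · obtain ⟨hD, hK⟩ := Classical.not_imp.1 hin
      have hc := isCircuitClosed_firstCircuits hσ j
      obtain ⟨q, hpq, hst⟩ : ∃ q, (dartPerm σ).SameCycle p q ∧
          IsStage d σ G H (firstCircuits σ (G ∆ H) j) q := by
        by_cases hb : G.Adj p.1 p.2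
        · exact ⟨p, Equiv.Perm.SameCycle.refl _ _, hG, hH, hσ, hc, hr, hD, hb, hK⟩
        -- The route must begin with a deletion; if `p` is an H-edge, the next dart of the circuit
        -- is a G-edge.
        · have h1 := trailDart_adj_and_colour hσ hD 1
          refine ⟨trailDart σ p 1, sameCycle_trailDart σ p 1, hG, hH, hσ, hc, hr, h1.1, ?_,
            hc.not_adj_trailDart hσ hK 1⟩
          rw [h1.2]
          simp [hb]
      have hsw : G ∆ firstCircuits σ (G ∆ H) (j + 1)
          = switched σ G (firstCircuits σ (G ∆ H) j) q (circuitLength σ q) := by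
        subst hp
        rw [firstCircuits_succ_eq_trail hσ hD hpq]
        rfl
      rw [hsw]
      refine ⟨hst.isRealization_switched_circuit, fun Z₀ Z h0 h1 => ?_⟩
      let Zm : JSState d := ⟨_, hr.isNearRealization⟩
      refine (hreach Z₀ Zm h0 rfl).trans (hst.reach_switched_circuit _ ?_ Zm Z rfl h1)
      intro Z' m hm h2 h3
      exact ⟨j, by omega, q, m, hm.trans (circuitLength_le σ q), h2, h3⟩

/-- The canonical route from the realization `G` to the realization `H`. -/
lemma reach_realization {G H : JSState d} {σ : Fin n → Equiv.Perm (Fin n)}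
    (hG : IsRealization d G.1) (hH : IsRealization d H.1)
    (hσ : σ ∈ pairings (G.1 ∆ H.1) G.1.Adj) :
    Relation.ReflTransGen (StepWithin (OnRoute G.1 H.1 σ)) G H := by
  refine (reach_firstCircuits hG hH hσ (n * n) le_rfl).2 G H rfl ?_
  rw [firstCircuits_last, symmDiff_symmDiff_cancel_left]

/-! ### Counting the routes through a state -/

/-- The auxiliary data that complete an encoding: the position `(j, q, m)` on the route and the
exceptional half-edges and edges. -/
abbrev RouteInfo (n : ℕ) : Type :=
  (Fin (n * n + 1) × (Fin n × Fin n) × Fin (n * n + 1)) ×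
    ((Fin n × Fin n) × (Fin n × Fin n)) × ((Fin n × Fin n) × (Fin n × Fin n))

lemma card_routeInfo (n : ℕ) : Fintype.card (RouteInfo n) = (n ^ 2 + 1) ^ 2 * n ^ 10 := by
  simp only [Fintype.card_prod, Fintype.card_fin]
  ring

/-- The symmetric difference that is encoded by `I` and `L` at the state `Z`. -/
def decodedDiff (Z : JSState d) (I : RouteInfo n) (L : JSState d) : SimpleGraph (Fin n) :=
  (L.1 ⊔ edge I.2.2.1.1 I.2.2.1.2 ⊔ edge I.2.2.2.1 I.2.2.2.2) ∆ Z.1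

/-- The set of edges that have been switched at the position recorded in `I`. -/
def decodedSwitch (Z : JSState d) (I : RouteInfo n) (L : JSState d)
    (σ : Fin n → Equiv.Perm (Fin n)) : SimpleGraph (Fin n) :=
  firstCircuits σ (decodedDiff Z I L) I.1.1 ⊔ trail σ I.1.2.1 I.1.2.2

lemma exists_encoding {G H Z : JSState d} {σ : Fin n → Equiv.Perm (Fin n)}
    (h : OnRoute G.1 H.1 σ Z) :
    ∃ x : RouteInfo n × JSState d, decodedDiff Z x.1 x.2 = G.1 ∆ H.1 ∧
      G.1 = Z.1 ∆ decodedSwitch Z x.1 x.2 σ ∧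
      σ ∈ pairings (decodedDiff Z x.1 x.2) (flipColour Z.1 x.1.2.1.1 x.1.2.1.2) := by
  obtain ⟨j, hj, q, m, hm, hZ, f₁, f₂, g₁, g₂, L, hL, hσ⟩ := h
  let I : RouteInfo n :=
    ((⟨j, Nat.lt_succ_of_le hj⟩, q, ⟨m, Nat.lt_succ_of_le hm⟩), (f₁, f₂), (g₁, g₂))
  have hD : decodedDiff Z I L = G.1 ∆ H.1 := by
    show (L.1 ⊔ edge g₁.1 g₁.2 ⊔ edge g₂.1 g₂.2) ∆ Z.1 = _
    rw [hL, symmDiff_symmDiff_cancel_right]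
  refine ⟨(I, L), hD, ?_, ?_⟩
  · show G.1 = Z.1 ∆ (firstCircuits σ (decodedDiff Z I L) j ⊔ trail σ q m)
    rw [hD, hZ]
    exact (symmDiff_symmDiff_cancel_right _ _).symm
  · show σ ∈ pairings (decodedDiff Z I L) (flipColour Z.1 f₁ f₂)
    rwa [hD]

/-- The pairs of realizations with a pairing whose route passes through `Z`. -/
def routesThrough (Z : JSState d) :
    Finset ((JSState d × JSState d) × (Fin n → Equiv.Perm (Fin n))) :=
  Finset.univ.filter fun t => OnRoute t.1.1.1 t.1.2.1 t.2 Z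

/-- The map sending a route to its encoding and its pairing is injective. For a fixed encoding the
admissible pairings number at most `pairingCount` of the decoded difference, so their weights add up
to at most 1. -/
lemma sum_routesThrough_le (Z : JSState d) :
    ∑ t ∈ routesThrough Z, 1 / (pairingCount (t.1.1.1 ∆ t.1.2.1) : ℝ)
      ≤ ((n : ℝ) ^ 2 + 1) ^ 2 * (n : ℝ) ^ 10 * Fintype.card (JSState d) := by
  rcases (routesThrough Z).eq_empty_or_nonempty with h0 | ⟨t₀, ht₀⟩
  · rw [h0, Finset.sum_empty]; positivity
  have : Nonempty (RouteInfo n × JSState d) :=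
    ⟨(exists_encoding (Finset.mem_filter.1 ht₀).2).choose⟩
  have hex : ∀ t ∈ routesThrough Z, ∃ x : RouteInfo n × JSState d,
      decodedDiff Z x.1 x.2 = t.1.1.1 ∆ t.1.2.1 ∧
      t.1.1.1 = Z.1 ∆ decodedSwitch Z x.1 x.2 t.2 ∧
      t.2 ∈ pairings (decodedDiff Z x.1 x.2) (flipColour Z.1 x.1.2.1.1 x.1.2.1.2) :=
    fun t ht => exists_encoding (Finset.mem_filter.1 ht).2
  choose! enc h1 h2 h3 using hex
  let P : RouteInfo n × JSState d → Finset (Fin n → Equiv.Perm (Fin n)) := fun x =>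
    pairings (decodedDiff Z x.1 x.2) (flipColour Z.1 x.1.2.1.1 x.1.2.1.2)
  let w : RouteInfo n × JSState d → ℝ := fun x => 1 / (pairingCount (decodedDiff Z x.1 x.2) : ℝ)
  have hw : ∀ x, 0 ≤ w x := fun x => by positivity
  let g : (RouteInfo n × JSState d) × (Fin n → Equiv.Perm (Fin n)) → ℝ := fun y =>
    if y.2 ∈ P y.1 then w y.1 else 0
  have hg : ∀ y, 0 ≤ g y := fun y => by
    simp only [g]
    split_ifs
    · exact hw _
    · exact le_rfl
  -- The encoding and `σ` give the switched edges, hence G; the decoded difference then gives H.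
  have hinj : Set.InjOn (fun t => (enc t, t.2)) (routesThrough Z : Set _) := by
    intro t ht t' ht' h
    simp only [Prod.mk.injEq] at h
    have e1 : t.1.1.1 = t'.1.1.1 := by rw [h2 t ht, h2 t' ht', h.1, h.2]
    have e2 : t.1.2.1 = t'.1.2.1 := by
      rw [← symmDiff_symmDiff_cancel_left t.1.1.1 t.1.2.1,
        ← symmDiff_symmDiff_cancel_left t'.1.1.1 t'.1.2.1, ← h1 t ht, ← h1 t' ht', h.1, e1]
    exact Prod.ext (Prod.ext (Subtype.ext e1) (Subtype.ext e2)) h.2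
  calc ∑ t ∈ routesThrough Z, 1 / (pairingCount (t.1.1.1 ∆ t.1.2.1) : ℝ)
      = ∑ t ∈ routesThrough Z, g (enc t, t.2) := by
        refine Finset.sum_congr rfl fun t ht => ?_
        simp only [g, P, w]
        rw [if_pos (h3 t ht), h1 t ht]
    _ = ∑ y ∈ (routesThrough Z).image fun t => (enc t, t.2), g y := (Finset.sum_image hinj).symm
    _ ≤ ∑ y, g y := Finset.sum_le_sum_of_subset_of_nonneg (Finset.subset_univ _) fun y _ _ => hg y
    _ = ∑ x, ∑ σ, g (x, σ) := Fintype.sum_prod_type _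
    _ ≤ ∑ _x : RouteInfo n × JSState d, (1 : ℝ) := by
        refine Finset.sum_le_sum fun x _ => ?_
        simp only [g]
        rw [← Finset.sum_filter, Finset.filter_mem_eq_inter, Finset.univ_inter, Finset.sum_const,
          nsmul_eq_mul]
        simp only [w]
        rw [mul_one_div, div_le_one (by exact_mod_cast pairingCount_pos _)]
        exact_mod_cast card_pairings_le _ _
    _ = _ := by
        rw [Finset.sum_const, nsmul_eq_mul, mul_one, Finset.card_univ, Fintype.card_prod,
          card_routeInfo]
        push_cast
        ring

/-- The number of states on a route. -/
lemma card_onRoute_le (G H : SimpleGraph (Fin n)) (σ : Fin n → Equiv.Perm (Fin n)) :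
    ((Finset.univ : Finset (JSState d)).filter (OnRoute G H σ)).card
      ≤ (n ^ 2 + 1) ^ 2 * n ^ 2 := by
  have hsub : (Finset.univ.filter (OnRoute (d := d) G H σ)).map (Function.Embedding.subtype _) ⊆
      (Finset.univ : Finset (Fin (n * n + 1) × (Fin n × Fin n) × Fin (n * n + 1))).image
        fun x => switched σ G (firstCircuits σ (G ∆ H) x.1) x.2.1 x.2.2 := by
    intro Z hZ
    rw [Finset.mem_map] at hZ
    obtain ⟨Z, hZ, rfl⟩ := hZ
    obtain ⟨j, hj, q, m, hm, h, _⟩ := (Finset.mem_filter.1 hZ).2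
    exact Finset.mem_image.2 ⟨(⟨j, Nat.lt_succ_of_le hj⟩, q, ⟨m, Nat.lt_succ_of_le hm⟩),
      Finset.mem_univ _, h.symm⟩
  have h1 := (Finset.card_le_card hsub).trans Finset.card_image_le
  rw [Finset.card_map, Finset.card_univ] at h1
  refine h1.trans (le_of_eq ?_)
  simp only [Fintype.card_prod, Fintype.card_fin]
  ring

/-! ### Constructing flows from families of paths -/

section Flows

variable {Ω : Type*} [Fintype Ω]

lemma mem_simplePaths {P : Ω → Ω → ℝ} {x y : Ω} {l : List Ω} :
    l ∈ simplePaths P x y ↔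
      l.Nodup ∧ l.IsChain (IsArc P) ∧ l.head? = some x ∧ l.getLast? = some y := by
  simp [simplePaths]

lemma simplePaths_unique {P : Ω → Ω → ℝ} {x y x' y' : Ω} {l : List Ω}
    (h : l ∈ simplePaths P x y) (h' : l ∈ simplePaths P x' y') : x' = x ∧ y' = y := by
  rw [mem_simplePaths] at h h'
  exact ⟨Option.some.inj (h'.2.2.1.symm.trans h.2.2.1),
    Option.some.inj (h'.2.2.2.symm.trans h.2.2.2)⟩

/-- Splitting the demand of each pair uniformly among a family of simple paths gives a flow. -/
lemma exists_flow {ι : Type*} (P : Ω → Ω → ℝ) (π : Ω → ℝ) (hπ : ∀ x, 0 ≤ π x)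
    (I : Ω → Ω → Finset ι) (hI : ∀ x y, (I x y).Nonempty) (l : Ω → Ω → ι → List Ω)
    (hl : ∀ x y, x ≠ y → ∀ i ∈ I x y, l x y i ∈ simplePaths P x y) :
    ∃ f : List Ω → ℝ, IsFlow P π f ∧
      (∀ p, 0 < f p → ∃ x y, x ≠ y ∧ ∃ i ∈ I x y, p = l x y i) ∧
      ∀ u v, edgeFlow P f u v ≤ ∑ x, ∑ y, if x ≠ y then
        ∑ i ∈ I x y, (if u ∈ l x y i then π x * π y / ((I x y).card : ℝ) else 0) else 0 := by
  let c : Ω → Ω → ℝ := fun x y => π x * π y / ((I x y).card : ℝ)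
  have hc : ∀ x y, 0 ≤ c x y := fun x y =>
    div_nonneg (mul_nonneg (hπ x) (hπ y)) (Nat.cast_nonneg _)
  let f : List Ω → ℝ := fun p => ∑ x, ∑ y, if x ≠ y then
    ∑ i ∈ I x y, (if l x y i = p then c x y else 0) else 0
  have hsum : ∀ A : Finset (List Ω), ∑ p ∈ A, f p = ∑ x, ∑ y, if x ≠ y then
      ∑ i ∈ I x y, (if l x y i ∈ A then c x y else 0) else 0 := by
    intro A
    simp only [f]
    rw [Finset.sum_comm]
    refine Finset.sum_congr rfl fun x _ => ?_
    rw [Finset.sum_comm]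
    refine Finset.sum_congr rfl fun y _ => ?_
    by_cases hxy : x ≠ y
    · simp only [if_pos hxy]
      rw [Finset.sum_comm]
      refine Finset.sum_congr rfl fun i _ => ?_
      rw [Finset.sum_ite_eq]
    · simp only [if_neg hxy, Finset.sum_const_zero]
  refine ⟨f, ⟨fun p _ => ?_, fun x y hxy => ?_⟩, fun p hp => ?_, fun u v => ?_⟩
  · refine Finset.sum_nonneg fun x _ => Finset.sum_nonneg fun y _ => ?_
    split_ifs
    · refine Finset.sum_nonneg fun i _ => ?_
      split_ifs
      · exact hc x y
      · exact le_rfl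
    · exact le_rfl
  · rw [hsum, Finset.sum_eq_single x, Finset.sum_eq_single y]
    · rw [if_pos hxy, Finset.sum_congr rfl fun i hi => if_pos (hl x y hxy i hi), Finset.sum_const,
        nsmul_eq_mul]
      have : ((I x y).card : ℝ) ≠ 0 := by exact_mod_cast (hI x y).card_pos.ne'
      exact mul_div_cancel₀ _ this
    · intro y' _ hy
      split_ifs with h
      · refine Finset.sum_eq_zero fun i hi => if_neg fun hmem => hy ?_
        exact (simplePaths_unique hmem (hl x y' h i hi)).2
      · rfl
    · simp
    · intro x' _ hx
      refine Finset.sum_eq_zero fun y' _ => ?_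
      split_ifs with h
      · refine Finset.sum_eq_zero fun i hi => if_neg fun hmem => hx ?_
        exact (simplePaths_unique hmem (hl x' y' h i hi)).1
      · rfl
    · simp
  · by_contra! hcon
    refine hp.ne' (Finset.sum_eq_zero fun x _ => Finset.sum_eq_zero fun y _ => ?_)
    split_ifs with h
    · exact Finset.sum_eq_zero fun i hi => if_neg fun e => hcon x y h i hi e.symm
    · rfl
  · unfold edgeFlow
    rw [hsum]
    refine Finset.sum_le_sum fun x _ => Finset.sum_le_sum fun y _ => ?_
    split_ifs with h
    · refine Finset.sum_le_sum fun i _ => ?_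
      split_ifs with h1 h2 h2
      · exact le_rfl
      · exact absurd ((Finset.mem_filter.1 h1).2.subset (by simp)) h2
      · exact hc x y
      · exact le_rfl
    · exact le_rfl

lemma sum_comp_le {α β : Type*} [Fintype α] [Fintype β] [DecidableEq β] (h : α → β) (φ : β → ℝ)
    (hφ : ∀ b, 0 ≤ φ b) (B : ℕ) (hB : ∀ b, (Finset.univ.filter fun a => h a = b).card ≤ B) :
    ∑ a, φ (h a) ≤ B * ∑ b, φ b := by
  rw [← Finset.sum_fiberwise Finset.univ h, Finset.mul_sum]
  refine Finset.sum_le_sum fun b _ => ?_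
  rw [Finset.sum_congr rfl (g := fun _ => φ b) fun a ha => by rw [(Finset.mem_filter.1 ha).2],
    Finset.sum_const, nsmul_eq_mul]
  exact mul_le_mul_of_nonneg_right (by exact_mod_cast hB b) (hφ b)

end Flows

/-! ### Simple paths in the state space graph of the JS chain -/

lemma walk_support_within {α : Type*} {Γ : SimpleGraph α} {Q : α → Prop}
    (hΓ : ∀ a b, Γ.Adj a b → Q b) {x y : α} (p : Γ.Walk x y) (hx : Q x) :
    ∀ z ∈ p.support, Q z := by
  induction p with
  | nil => intro z hz; rw [Walk.mem_support_nil_iff] at hz; rwa [hz]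
  | cons h p ih =>
    intro z hz
    rw [Walk.support_cons, List.mem_cons] at hz
    rcases hz with rfl | hz
    · exact hx
    · exact ih (hΓ _ _ h) z hz

/-- Moves are reversible, so the steps within `Q` form an undirected graph; erasing the loops of a
walk leaves a simple path that still stays within `Q`. -/
lemma exists_simplePath {Q : JSState d → Prop} {x y : JSState d} (hx : Q x)
    (h : Relation.ReflTransGen (StepWithin Q) x y) :
    ∃ l ∈ simplePaths (jsP d) x y, ∀ z ∈ l, Q z := by
  let Γ : SimpleGraph (JSState d) :=
    { Adj := StepWithin Q
      symm := ⟨fun a b h => ⟨h.1.symm, h.2.2, h.2.1⟩⟩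
      loopless := ⟨fun a h => h.1.1 rfl⟩ }
  obtain ⟨p⟩ := (Γ.reachable_iff_reflTransGen x y).2 h
  refine ⟨p.bypass.support, mem_simplePaths.2 ⟨(p.bypass_isPath).support_nodup, ?_, ?_, ?_⟩,
    walk_support_within (fun a b (h : StepWithin Q a b) => h.2.2) _ hx⟩
  · exact p.bypass.isChain_adj_support.imp fun a b (h : StepWithin Q a b) => h.1
  · rw [List.head?_eq_some_head p.bypass.support_ne_nil, Walk.head_support]
  · rw [List.getLast?_eq_some_getLast p.bypass.support_ne_nil, Walk.getLast_support]

lemma StepWithin.mono {Q Q' : JSState d → Prop} (hQ : ∀ z, Q z → Q' z) {x y : JSState d}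
    (h : Relation.ReflTransGen (StepWithin Q) x y) :
    Relation.ReflTransGen (StepWithin Q') x y :=
  h.lift id fun _ _ h => ⟨h.1, hQ _ h.2.1, hQ _ h.2.2⟩

lemma StepWithin.reverse {Q : JSState d → Prop} {x y : JSState d}
    (h : Relation.ReflTransGen (StepWithin Q) x y) :
    Relation.ReflTransGen (StepWithin Q) y x := by
  induction h with
  | refl => exact Relation.ReflTransGen.refl
  | tail _ h ih => exact Relation.ReflTransGen.head ⟨h.1.symm, h.2.2, h.2.1⟩ ih

lemma reach_of_chain {x y : JSState d} {l : List (JSState d)} (hl : l.IsChain (IsArc (jsP d)))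
    (hx : l.head? = some x) (hy : l.getLast? = some y) :
    Relation.ReflTransGen (StepWithin (· ∈ l)) x y := by
  induction l generalizing x with
  | nil => simp at hx
  | cons a l ih =>
    obtain rfl : a = x := by simpa using hx
    cases l with
    | nil =>
      obtain rfl : a = y := by simpa using hy
      exact Relation.ReflTransGen.refl
    | cons b l =>
      rw [List.isChain_cons_cons] at hl
      have := ih hl.2 (x := b) rfl (by simpa using hy)
      exact Relation.ReflTransGen.head ⟨hl.1, by simp, by simp⟩
        (StepWithin.mono (fun z hz => List.mem_cons_of_mem _ hz) this)

/-! ### Balls in the state space graph and retraction to the realizations -/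

/-- The states at distance at most `m` from `z`. -/
def stateBall (z : JSState d) : ℕ → Finset (JSState d)
  | 0 => {z}
  | m + 1 => stateBall z m ∪ (stateBall z m).biUnion fun x =>
      Finset.univ.filter fun y => IsArc (jsP d) x y

/-- A neighbour is determined by the nodes i, j, k of the move that leads to it. -/
lemma card_arcs_le (x : JSState d) :
    (Finset.univ.filter fun y => IsArc (jsP d) x y).card ≤ n ^ 3 := by
  have hsub : (Finset.univ.filter fun y => IsArc (jsP d) x y).map (Function.Embedding.subtype _) ⊆
      (Finset.univ : Finset (Fin n × Fin n × Fin n)).image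
        fun t => (x.1 ∆ edge t.1 t.2.1) ∆ edge t.2.1 t.2.2 := by
    intro Z hZ
    rw [Finset.mem_map] at hZ
    obtain ⟨y, hy, rfl⟩ := hZ
    have hy := (Finset.mem_filter.1 hy).2
    obtain ⟨i, j, hij, hm⟩ := exists_jsMove_of_isArc hy
    obtain ⟨⟨k, hk⟩, _⟩ := jsMove_pos hy.1 hij hm
    exact Finset.mem_image.2 ⟨(i, j, k), Finset.mem_univ _, hk.symm⟩
  have h1 := (Finset.card_le_card hsub).trans Finset.card_image_le
  rw [Finset.card_map, Finset.card_univ] at h1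
  refine h1.trans (le_of_eq ?_)
  simp only [Fintype.card_prod, Fintype.card_fin]
  ring

lemma card_stateBall_le (z : JSState d) (m : ℕ) : (stateBall z m).card ≤ (n ^ 3 + 1) ^ m := by
  induction m with
  | zero => simp [stateBall]
  | succ m ih =>
    calc (stateBall z (m + 1)).card
        ≤ (stateBall z m).card + (stateBall z m).card * n ^ 3 :=
          (Finset.card_union_le _ _).trans (Nat.add_le_add_left
            (Finset.card_biUnion_le_card_mul _ _ _ fun x _ => card_arcs_le x) _)
      _ = (stateBall z m).card * (n ^ 3 + 1) := by ring
      _ ≤ _ := by rw [pow_succ]; exact Nat.mul_le_mul_right _ ih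

lemma stateBall_mono (z : JSState d) : Monotone (stateBall z) :=
  monotone_nat_of_le_succ fun _ => Finset.subset_union_left

lemma mem_stateBall_of_chain {x z : JSState d} {l : List (JSState d)}
    (hl : l.IsChain (IsArc (jsP d))) (hx : l.head? = some x) (hz : z ∈ l) :
    x ∈ stateBall z (l.length - 1) := by
  induction l generalizing x with
  | nil => simp at hx
  | cons a l ih =>
    obtain rfl : a = x := by simpa using hx
    rcases List.mem_cons.1 hz with rfl | hz'
    · exact stateBall_mono z (Nat.zero_le _) (by simp [stateBall])
    · cases l with
      | nil => simp at hz'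
      | cons b l =>
        rw [List.isChain_cons_cons] at hl
        have := ih hl.2 (x := b) rfl hz'
        show a ∈ stateBall z (l.length + 1)
        exact Finset.mem_union_right _ (Finset.mem_biUnion.2
          ⟨b, this, Finset.mem_filter.2 ⟨Finset.mem_univ _, hl.1.symm⟩⟩)

/-- If `kJS d ≤ k`, every state has a path of length at most `k` to a realization. -/
lemma exists_short_path {k : ℕ} (hk : kJS d ≤ k) (x : JSState d) :
    ∃ h : JSState d, IsRealization d h.1 ∧ ∃ l ∈ simplePaths (jsP d) x h, l.length - 1 ≤ k := by
  have h1 := (le_iSup (fun G : JSState d => ⨅ H : {H : JSState d // IsRealization d H.1},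
    ⨅ l ∈ simplePaths (jsP d) G H.1, (pathLength l : ℕ∞)) x).trans hk
  -- A strict bound on an infimum yields a witness, so `≤ k` is weakened to `< k + 1`.
  have h2 := lt_of_le_of_lt h1 (show (k : ℕ∞) < ((k + 1 : ℕ) : ℕ∞) by exact_mod_cast k.lt_succ_self)
  simp only [iInf_lt_iff] at h2
  obtain ⟨H, l, hl, hlt⟩ := h2
  refine ⟨H.1, H.2, l, hl, ?_⟩
  have : pathLength l < k + 1 := by exact_mod_cast hlt
  unfold pathLength at this
  omega

/-- A realization near each state, with a small connected set of states that joins them. -/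
lemma exists_retraction {k : ℕ} (hk : kJS d ≤ k) :
    ∃ (h : JSState d → JSState d) (S : JSState d → Finset (JSState d)),
      (∀ x, IsRealization d (h x).1) ∧ (∀ x, x ∈ S x) ∧ (∀ x, h x ∈ S x) ∧
      (∀ x, (S x).card ≤ k + 1) ∧
      (∀ x, Relation.ReflTransGen (StepWithin (· ∈ S x)) x (h x)) ∧
      ∀ z, (Finset.univ.filter fun x => z ∈ S x).card ≤ (n ^ 3 + 1) ^ k := by
  choose h hr l hl hlen using exists_short_path hk
  have hl' := fun x => mem_simplePaths.1 (hl x)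
  refine ⟨h, fun x => (l x).toFinset, hr, fun x => ?_, fun x => ?_, fun x => ?_, fun x => ?_,
    fun z => ?_⟩
  · exact List.mem_toFinset.2 (List.mem_of_head? (hl' x).2.2.1)
  · exact List.mem_toFinset.2 (List.mem_of_getLast? (hl' x).2.2.2)
  · have := (l x).toFinset_card_le
    have := hlen x
    show (l x).toFinset.card ≤ k + 1
    omega
  · exact StepWithin.mono (fun z hz => List.mem_toFinset.2 hz)
      (reach_of_chain (hl' x).2.1 (hl' x).2.2.1 (hl' x).2.2.2)
  -- Read backwards, the path shows that each such x lies in the ball of radius k around z.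
  · refine le_trans (Finset.card_le_card fun x hx => ?_) (card_stateBall_le z k)
    have hx := List.mem_toFinset.1 (Finset.mem_filter.1 hx).2
    exact stateBall_mono z (hlen x) (mem_stateBall_of_chain (hl' x).2.1 (hl' x).2.2.1 hx)

/-! ### The multicommodity flow -/

lemma one_lt_of_realization {G : SimpleGraph (Fin n)} (hn : 0 < n) (hd : ∀ i, 0 < d i)
    (hG : IsRealization d G) : 1 < n := by
  have h1 : 0 < G.degree ⟨0, hn⟩ := by rw [hG]; exact hd _
  have h2 := G.degree_lt_card_verts ⟨0, hn⟩
  rw [Fintype.card_fin] at h2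
  omega

/-- Each realization is `h x` for at most `B` states x, so replacing pairs of states by pairs of
realizations costs a factor of at most `B ^ 2`. -/
lemma sum_routes_le {h : JSState d → JSState d} {B : ℕ}
    (hB : ∀ G, (Finset.univ.filter fun x => h x = G).card ≤ B) (Z : JSState d) :
    ∑ x, ∑ y, ∑ σ ∈ pairings ((h x).1 ∆ (h y).1) (h x).1.Adj,
        (if OnRoute (h x).1 (h y).1 σ Z then 1 / (pairingCount ((h x).1 ∆ (h y).1) : ℝ) else 0)
      ≤ (B : ℝ) ^ 2 * (((n : ℝ) ^ 2 + 1) ^ 2 * (n : ℝ) ^ 10 * Fintype.card (JSState d)) := by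
  let φ : JSState d → JSState d → ℝ := fun G H => ∑ σ ∈ pairings (G.1 ∆ H.1) G.1.Adj,
    (if OnRoute G.1 H.1 σ Z then 1 / (pairingCount (G.1 ∆ H.1) : ℝ) else 0)
  have hterm : ∀ (G H : JSState d) (σ : Fin n → Equiv.Perm (Fin n)),
      0 ≤ (if OnRoute G.1 H.1 σ Z then 1 / (pairingCount (G.1 ∆ H.1) : ℝ) else 0) := by
    intro G H σ
    split_ifs <;> positivity
  have hφ : ∀ G H, 0 ≤ φ G H := fun G H => Finset.sum_nonneg fun σ _ => hterm G H σ
  calc ∑ x, ∑ y, φ (h x) (h y)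
      ≤ B * ∑ G, ∑ y, φ G (h y) :=
        sum_comp_le h (fun G => ∑ y, φ G (h y)) (fun G => Finset.sum_nonneg fun y _ => hφ _ _) B hB
    _ ≤ B * ∑ G, (B * ∑ H, φ G H) := by
        refine mul_le_mul_of_nonneg_left (Finset.sum_le_sum fun G _ => ?_) (Nat.cast_nonneg _)
        exact sum_comp_le h (φ G) (hφ G) B hB
    _ = (B : ℝ) ^ 2 * ∑ G, ∑ H, φ G H := by rw [← Finset.mul_sum]; ring
    _ ≤ (B : ℝ) ^ 2 * ∑ t ∈ routesThrough Z, 1 / (pairingCount (t.1.1.1 ∆ t.1.2.1) : ℝ) := by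
        refine mul_le_mul_of_nonneg_left ?_ (by positivity)
        unfold routesThrough
        rw [Finset.sum_filter, Fintype.sum_prod_type, Fintype.sum_prod_type]
        refine Finset.sum_le_sum fun G _ => Finset.sum_le_sum fun H _ => ?_
        exact Finset.sum_le_sum_of_subset_of_nonneg (Finset.subset_univ _)
          fun σ _ _ => hterm G H σ
    _ ≤ _ := mul_le_mul_of_nonneg_left (sum_routesThrough_le Z) (by positivity)

/-- The flow through an arc is bounded by the flow through its tail u. With B = (n^3+1)^k and N
states, the initial and the final segments through u each account for at most B N pairs, and the
canonical routes for at most B^2 times a polynomial times N; every pair has demand 1/N^2. -/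
lemma exists_efficient_flow {k : ℕ} (hk : kJS d ≤ k) (hn : 0 < n)
    {G₀ : SimpleGraph (Fin n)} (hG₀ : IsRealization d G₀) :
    ∃ f : List (JSState d) → ℝ, IsFlow (jsP d) (uniformDist (JSState d)) f ∧
      (∀ G G' : JSState d, edgeFlow (jsP d) f G G' ≤
        (2 * ((n : ℝ) ^ 3 + 1) ^ k + (((n : ℝ) ^ 3 + 1) ^ k) ^ 2 *
          (((n : ℝ) ^ 2 + 1) ^ 2 * (n : ℝ) ^ 10)) / (Fintype.card (JSState d) : ℝ)) ∧
      (∀ l ∈ allSimplePaths (jsP d), 0 < f l →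
        (pathLength l : ℝ) ≤ 2 * ((k : ℝ) + 1) + ((n : ℝ) ^ 2 + 1) ^ 2 * (n : ℝ) ^ 2) := by
  obtain ⟨h, S, hr, hxS, hhS, hScard, hSreach, hSball⟩ := exists_retraction hk
  let I : JSState d → JSState d → Finset (Fin n → Equiv.Perm (Fin n)) := fun x y =>
    pairings ((h x).1 ∆ (h y).1) (h x).1.Adj
  have hIcard : ∀ x y, (I x y).card = pairingCount ((h x).1 ∆ (h y).1) := fun x y =>
    card_pairings_realization (hr x) (hr y)
  have hI : ∀ x y, (I x y).Nonempty := fun x y =>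
    Finset.card_pos.1 (by rw [hIcard]; exact pairingCount_pos _)
  have hpath : ∀ x y σ, ∃ l, σ ∈ I x y → l ∈ simplePaths (jsP d) x y ∧
      ∀ z ∈ l, z ∈ S x ∨ z ∈ S y ∨ OnRoute (h x).1 (h y).1 σ z := by
    intro x y σ
    by_cases hσ : σ ∈ I x y
    · have h1 : Relation.ReflTransGen
          (StepWithin fun z => z ∈ S x ∨ z ∈ S y ∨ OnRoute (h x).1 (h y).1 σ z) x y :=
        ((StepWithin.mono (fun z hz => Or.inl hz) (hSreach x)).trans
          (StepWithin.mono (fun z hz => Or.inr (Or.inr hz))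
            (reach_realization (hr x) (hr y) hσ))).trans
          (StepWithin.mono (fun z hz => Or.inr (Or.inl hz)) (StepWithin.reverse (hSreach y)))
      obtain ⟨l, hl, hl'⟩ := exists_simplePath (Or.inl (hxS x)) h1
      exact ⟨l, fun _ => ⟨hl, hl'⟩⟩
    · exact ⟨[], fun h' => absurd h' hσ⟩
  choose l hl using hpath
  have : Nonempty (JSState d) := ⟨⟨G₀, hG₀.isNearRealization⟩⟩
  set N : ℝ := (Fintype.card (JSState d) : ℝ) with hN
  have hNpos : 0 < N := by rw [hN]; exact_mod_cast Fintype.card_pos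
  obtain ⟨f, hf, hfpos, hfedge⟩ := exists_flow (jsP d) (uniformDist (JSState d))
    (fun _ => by unfold uniformDist; positivity) I hI l
    (fun x y _ σ hσ => (hl x y σ hσ).1)
  refine ⟨f, hf, fun u v => (hfedge u v).trans ?_, ?_⟩
  · let w : JSState d → JSState d → ℝ := fun x y => 1 / (pairingCount ((h x).1 ∆ (h y).1) : ℝ)
    let R : JSState d → JSState d → ℝ := fun x y =>
      ∑ σ ∈ I x y, if OnRoute (h x).1 (h y).1 σ u then w x y else 0
    have hw : ∀ x y, 0 < w x y := fun x y =>
      one_div_pos.2 (by exact_mod_cast pairingCount_pos _)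
    have hbound : ∀ x y, (if x ≠ y then ∑ σ ∈ I x y, (if u ∈ l x y σ then
        uniformDist (JSState d) x * uniformDist (JSState d) y / ((I x y).card : ℝ) else 0) else 0)
        ≤ 1 / N ^ 2 * ((if u ∈ S x then 1 else 0) + (if u ∈ S y then 1 else 0) + R x y) := by
      intro x y
      have hone : ∑ _σ ∈ I x y, w x y = 1 := by
        rw [Finset.sum_const, nsmul_eq_mul, hIcard]
        exact mul_one_div_cancel (by exact_mod_cast (pairingCount_pos _).ne')
      -- The weights of the pairings add up to 1, so the first two indicators can be spread over the
      -- pairings and the bound checked term by term.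
      have hR : (if u ∈ S x then (1 : ℝ) else 0) + (if u ∈ S y then 1 else 0) + R x y
          = ∑ σ ∈ I x y, ((if u ∈ S x then w x y else 0) + (if u ∈ S y then w x y else 0)
            + if OnRoute (h x).1 (h y).1 σ u then w x y else 0) := by
        rw [Finset.sum_add_distrib, Finset.sum_add_distrib]
        congr 2
        · split_ifs
          · exact hone.symm
          · simp
        · split_ifs
          · exact hone.symm
          · simp
      have hnn : 0 ≤ 1 / N ^ 2 *
          ((if u ∈ S x then 1 else 0) + (if u ∈ S y then 1 else 0) + R x y) := by
        have : 0 ≤ R x y := Finset.sum_nonneg fun σ _ => by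
          split_ifs
          · exact (hw x y).le
          · exact le_rfl
        positivity
      by_cases hxy : x ≠ y
      · rw [if_pos hxy, hR, Finset.mul_sum]
        refine Finset.sum_le_sum fun σ hσ => ?_
        have hw0 := (hw x y).le
        have hc : uniformDist (JSState d) x * uniformDist (JSState d) y / ((I x y).card : ℝ)
            = 1 / N ^ 2 * w x y := by
          rw [hIcard]
          simp only [uniformDist, w, ← hN]
          ring
        rw [hc]
        by_cases hu : u ∈ l x y σ
        · rw [if_pos hu]
          refine mul_le_mul_of_nonneg_left ?_ (by positivity)
          rcases (hl x y σ hσ).2 u hu with h1 | h1 | h1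
          · rw [if_pos h1]
            split_ifs <;> linarith
          · rw [if_pos h1]
            split_ifs <;> linarith
          · rw [if_pos h1]
            split_ifs <;> linarith
        · rw [if_neg hu]
          refine mul_nonneg (by positivity) ?_
          split_ifs <;> linarith
      · rw [if_neg hxy]
        exact hnn
    have hS1 : ∑ x : JSState d, (if u ∈ S x then (1 : ℝ) else 0) ≤ ((n : ℝ) ^ 3 + 1) ^ k := by
      rw [Finset.sum_boole]
      exact_mod_cast hSball u
    have hfib : ∀ G, (Finset.univ.filter fun x => h x = G).card ≤ (n ^ 3 + 1) ^ k := fun G =>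
      le_trans (Finset.card_le_card fun x hx => by
        rw [Finset.mem_filter] at hx ⊢
        exact ⟨hx.1, hx.2 ▸ hhS x⟩) (hSball G)
    have hroutes := sum_routes_le hfib u
    rw [← hN] at hroutes
    push_cast at hroutes
    refine le_trans (Finset.sum_le_sum fun x _ => Finset.sum_le_sum fun y _ =>
      le_of_eq_of_le (by congr!) (hbound x y)) ?_
    calc ∑ x, ∑ y, 1 / N ^ 2 *
          ((if u ∈ S x then 1 else 0) + (if u ∈ S y then 1 else 0) + R x y)
        = 1 / N ^ 2 * (2 * (N * ∑ x : JSState d, (if u ∈ S x then (1 : ℝ) else 0))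
            + ∑ x, ∑ y, R x y) := by
          simp only [← Finset.mul_sum, Finset.sum_add_distrib, Finset.sum_const, nsmul_eq_mul,
            Finset.card_univ, ← hN]
          ring
      _ ≤ 1 / N ^ 2 * (2 * (N * ((n : ℝ) ^ 3 + 1) ^ k) + (((n : ℝ) ^ 3 + 1) ^ k) ^ 2 *
            (((n : ℝ) ^ 2 + 1) ^ 2 * (n : ℝ) ^ 10 * N)) := by
          gcongr
      _ = _ := by
          field_simp
  · intro p _ hp
    obtain ⟨x, y, hxy, σ, hσ, rfl⟩ := hfpos p hp
    obtain ⟨h1, h2⟩ := hl x y σ hσ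
    have hsub : (l x y σ).toFinset ⊆
        S x ∪ S y ∪ Finset.univ.filter (OnRoute (h x).1 (h y).1 σ) := by
      intro z hz
      have := h2 z (List.mem_toFinset.1 hz)
      simp only [Finset.mem_union, Finset.mem_filter, Finset.mem_univ, true_and]
      tauto
    have h3 := Finset.card_le_card hsub
    rw [List.toFinset_card_of_nodup (mem_simplePaths.1 h1).1] at h3
    have h4 := Finset.card_union_le (S x ∪ S y)
      (Finset.univ.filter (OnRoute (h x).1 (h y).1 σ))
    have h5 := Finset.card_union_le (S x) (S y)
    have h6 := card_onRoute_le (d := d) (h x).1 (h y).1 σ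
    have h7 := hScard x
    have h8 := hScard y
    have h9 : pathLength (l x y σ) ≤ 2 * (k + 1) + (n ^ 2 + 1) ^ 2 * n ^ 2 := by
      unfold pathLength
      omega
    exact_mod_cast h9

end

/-! ### The theorem -/

theorem theorem3p4 (𝒟 : (n : ℕ) → Set (Fin n → ℕ)) (k : ℕ)
    (h𝒟 : IsGraphicalFamily 𝒟) (hk : IsStronglyStable 𝒟 k) :
    ∃ p r s : Polynomial ℝ, ∀ n, ∀ d ∈ 𝒟 n,
      IsReversibleChain (jsP d) (uniformDist (JSState d)) ∧
      (∃ f : List (JSState d) → ℝ,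
        IsFlow (jsP d) (uniformDist (JSState d)) f ∧
        (∀ G G' : JSState d, IsArc (jsP d) G G' →
          edgeFlow (jsP d) f G G' ≤ p.eval (n : ℝ) / (Fintype.card (JSState d) : ℝ)) ∧
        (∀ l ∈ allSimplePaths (jsP d), 0 < f l → (pathLength l : ℝ) ≤ r.eval (n : ℝ))) ∧
      (∀ G G' : JSState d, IsArc (jsP d) G G' → 1 / jsP d G G' ≤ s.eval (n : ℝ)) ∧
      Real.log (Fintype.card (JSState d) : ℝ) ≤ s.eval (n : ℝ) := by
  -- The last polynomial is the sum of the bound 2n^3 for 1/P and the bound n^2 for the logarithm of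
  -- the number of states.
  refine ⟨2 * (.X ^ 3 + 1) ^ k + ((.X ^ 3 + 1) ^ k) ^ 2 * ((.X ^ 2 + 1) ^ 2 * .X ^ 10),
    2 * (.C (k : ℝ) + 1) + (.X ^ 2 + 1) ^ 2 * .X ^ 2, 2 * .X ^ 3 + .X ^ 2, fun n d hd => ?_⟩
  obtain ⟨hn, hpos, G₀, hG₀⟩ := h𝒟 n d hd
  have hkd := hk n d hd
  refine ⟨isReversibleChain_jsP (one_lt_of_realization hn hpos hG₀) hG₀, ?_, fun G G' h => ?_, ?_⟩
  · obtain ⟨f, h1, h2, h3⟩ := exists_efficient_flow hkd hn hG₀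
    refine ⟨f, h1, fun G G' _ => ?_, fun l hl hfl => ?_⟩
    · simpa using h2 G G'
    · simpa using h3 l hl hfl
  · have := one_div_jsP_le h
    simp only [Polynomial.eval_add, Polynomial.eval_mul, Polynomial.eval_pow, Polynomial.eval_X,
      Polynomial.eval_ofNat]
    nlinarith [sq_nonneg (n : ℝ)]
  · have := log_card_state_le (d := d)
    simp only [Polynomial.eval_add, Polynomial.eval_mul, Polynomial.eval_pow, Polynomial.eval_X,
      Polynomial.eval_ofNat]
    have : (0 : ℝ) ≤ 2 * (n : ℝ) ^ 3 := by positivity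
    linarith
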